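/- Fix a finite abelian group $H$ with exponent $m$. Let $\mathcal L$ be the first-order language $\{\cdot,1,{}^{-1},\le,\tau,P_n\ (n\ge 2)\}$. A \emph{pre-ordered abelian group} is an abelian group $G$ with a relation $\le$ that is reflexive, transitive, total ($g\le h$ or $h\le g$) and satisfies $g\le h\Rightarrow gj\le hj$; write $g\sim h$ for $g\le h\wedge h\le g$, and call $g$ positive if $1\le g$ and $g\not\sim 1$. A totally ordered abelian group $A$ is a \emph{model of Presburger arithmetic} if it has a least positive element $t$ and, for every $n\ge2$, every element of $A$ is an $n$-th power times one of $1,t,\dots,t^{n-1}$ (i.e. $A$ is a $\mathbb Z$-group). Let $\mathcal T_H$ be the $\mathcal L$-theory with the following axioms: the axioms of pre-ordered abelian groups; $P_n$ is the subgroup of $n$-th powers, for each $n\ge2$; there is no element of order $k$, for each $k\ge1$ not dividing $m$; the torsion subgroup $\{g:g^m=1\}$ is isomorphic to $H$; if $g\sim1$ then $g$ is torsion; $\le$ is trivial on the torsion subgroup (any two torsion elements $g,h$ satisfy $g\le h$); and the quotient by the torsion subgroup, which is totally ordered, is a model of Presburger arithmetic whose least positive element is the class of $\tau$. \textbf{Theorem.}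 (1) $\mathcal T_H$ is model-complete: every $\mathcal L$-formula is equivalent, in all models of $\mathcal T_H$, to an existential $\mathcal L$-formula. (2) $\mathcal T_H$ axiomatizes the intended class: an abelian group $G$ with a binary relation $\le$, an element $\tau\in G$ and $P_n$ interpreted as the subgroup of $n$-th powers is a model of $\mathcal T_H$ if and only if $(G,\le)$ is a pre-ordered abelian group whose torsion subgroup is isomorphic to $H$, whose order is trivial on the torsion subgroup, and whose quotient by the torsion subgroup is a model of Presburger arithmetic with the class of $\tau$ as least positive element. (3) Let $(G,\le)$ be a finite-by-Presburger group, i.e. a pre-ordered abelian group such that $\{g: g\sim1\}$ is finite and the quotient of $G$ by it is a model of Presburger arithmetic, and suppose $\{g:g\sim 1\}\cong H$. Then there is $\tau\in G$ that is least positive up to $\sim$ (it is positive, and $\tau\le g$ for every positive $g$); and for every such $\tau$ the $\mathcal L$-structure $(G,\cdot,1,{}^{-1},\le,\tau,(P_n)_{n\ge2})$, with $P_n$ the subgroup of $n$-th powers, is a model of $\mathcal T_H$, and its complete theory is model-complete. -/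

import Mathlib

open FirstOrder FirstOrder.Language

namespace FinByPres

/-! ### Pre-ordered abelian groups and finite-by-Presburger groups -/

/-- A pre-ordered abelian group (written multiplicatively): a total pre-order that is
compatible with multiplication. -/
structure IsPreorderedGroup {G : Type*} [CommGroup G] (le : G → G → Prop) : Prop where
  refl : ∀ g, le g g
  trans : ∀ g h j, le g h → le h j → le g j
  total : ∀ g h, le g h ∨ le h g
  mul_right : ∀ g h j, le g h → le (g * j) (h * j)

/-- `t` is the least positive element (up to `∼`, when `le` is only a pre-order);
positive means strictly above `1`. -/
def IsLeastPositive {G : Type*} [CommGroup G] (le : G → G → Prop) (t : G) : Prop :=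
  (le 1 t ∧ ¬ le t 1) ∧ ∀ g, le 1 g → ¬ le g 1 → le t g

/-- The ordered abelian group `(A, le)` is a model of Presburger arithmetic with `t` as the
distinguished element (a `ℤ`-group, in multiplicative notation): it is totally ordered, `t` is the
least positive element, and for all `n ≥ 2` every element is an `n`-th power times one of
`1, t, …, t ^ (n - 1)`. -/
structure IsPresburger {A : Type*} [CommGroup A] (le : A → A → Prop) (t : A) : Prop
    extends IsPreorderedGroup le where
  antisymm : ∀ a b, le a b → le b a → a = b
  least : IsLeastPositive le t
  division : ∀ n : ℕ, 2 ≤ n → ∀ a, ∃ b, ∃ i < n, a = b ^ n * t ^ i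

/-- The relation induced by `le` on the quotient `G ⧸ K`:
`x ≤ y` iff `x` and `y` have representatives `g` and `h` with `g ≤ h`. -/
def quotientLE {G : Type*} [CommGroup G] (le : G → G → Prop) (K : Subgroup G) :
    G ⧸ K → G ⧸ K → Prop :=
  Relation.Map le (QuotientGroup.mk' K) (QuotientGroup.mk' K)

/-- The subgroup `{g | g ∼ 1}`, where `g ∼ h` means `g ≤ h` and `h ≤ g`. -/
def simSubgroup {G : Type*} [CommGroup G] {le : G → G → Prop} (hG : IsPreorderedGroup le) :
    Subgroup G where
  carrier := {g | le g 1 ∧ le 1 g}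
  one_mem' := ⟨hG.refl 1, hG.refl 1⟩
  mul_mem' := by
    rintro a b ⟨ha, ha'⟩ ⟨hb, hb'⟩
    have h1 := hG.mul_right _ _ b ha
    have h2 := hG.mul_right _ _ b ha'
    rw [one_mul] at h1 h2
    exact ⟨hG.trans _ _ _ h1 hb, hG.trans _ _ _ hb' h2⟩
  inv_mem' := by
    rintro a ⟨ha, ha'⟩
    have h1 := hG.mul_right _ _ a⁻¹ ha
    have h2 := hG.mul_right _ _ a⁻¹ ha'
    rw [mul_inv_cancel, one_mul] at h1 h2
    exact ⟨h2, h1⟩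

/-- `(G, le)` is finite-by-Presburger: `{g | g ∼ 1}` is finite and the quotient by it, with the
induced order, is a model of Presburger arithmetic. -/
def IsFiniteByPresburger {G : Type*} [CommGroup G] {le : G → G → Prop}
    (hG : IsPreorderedGroup le) : Prop :=
  Finite (simSubgroup hG) ∧ ∃ t, IsPresburger (quotientLE le (simSubgroup hG)) t

/-- `(G, le)` with the constant `τ` is a pre-ordered abelian group whose torsion subgroup is
(isomorphic to) `H`, whose order is trivial on the torsion subgroup, and whose quotient by the
torsion subgroup is a model of Presburger arithmetic with the class of `τ` as least positive
element. -/
structure IsPresburgerModulo (H : Type*) [CommGroup H] {G : Type*} [CommGroup G]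
    (le : G → G → Prop) (τ : G) : Prop extends IsPreorderedGroup le where
  torsion_equiv : Nonempty (CommGroup.torsion G ≃* H)
  trivial_on_torsion : ∀ g ∈ CommGroup.torsion G, ∀ h ∈ CommGroup.torsion G, le g h
  quotient : IsPresburger (quotientLE le (CommGroup.torsion G)) (QuotientGroup.mk τ)

/-! ### The language `{·, 1, ⁻¹, ≤, τ, P_n (n ≥ 2)}` -/

inductive Func : ℕ → Type
  | one : Func 0
  | tau : Func 0
  | inv : Func 1
  | mul : Func 2

inductive Rel : ℕ → Type
  | le : Rel 2
  | pow (n : ℕ) (hn : 2 ≤ n) : Rel 1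

/-- The language `{·, 1, ⁻¹, ≤, τ, P_n (n ≥ 2)}`. -/
abbrev lang : Language := ⟨Func, Rel⟩

/-- The expansion of a pre-ordered group by the constant `τ` and the subgroups `P_n` of
`n`-th powers. -/
@[reducible] def enrich {G : Type*} [CommGroup G] (le : G → G → Prop) (τ : G) : lang.Structure G where
  funMap
    | Func.one, _ => 1
    | Func.tau, _ => τ
    | Func.inv, x => (x 0)⁻¹
    | Func.mul, x => x 0 * x 1
  RelMap
    | Rel.le, x => le (x 0) (x 1)
    | Rel.pow n _, x => ∃ h : G, h ^ n = x 0

section Formulas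

variable {α : Type*} {n : ℕ}

instance : One (lang.Term α) := ⟨Constants.term (L := lang) Func.one⟩
instance : Mul (lang.Term α) := ⟨Functions.apply₂ (L := lang) Func.mul⟩
instance : Inv (lang.Term α) := ⟨Functions.apply₁ (L := lang) Func.inv⟩
instance : Pow (lang.Term α) ℕ := ⟨fun t k => k.rec 1 (fun _ s => s * t)⟩

/-- The constant symbol `τ` as a term. -/
def tauT : lang.Term α := Constants.term (L := lang) Func.tau

/-- The formula `s ≤ t`. -/
def leF (s t : lang.Term (α ⊕ Fin n)) : lang.BoundedFormula α n :=
  Relations.boundedFormula₂ (L := lang) Rel.le s t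

/-- The formula `P_k(t)`. -/
def powF (k : ℕ) (hk : 2 ≤ k) (t : lang.Term (α ⊕ Fin n)) : lang.BoundedFormula α n :=
  Relations.boundedFormula₁ (L := lang) (Rel.pow k hk) t

/-- The formula "`t` is positive": `1 ≤ t` and not `t ≤ 1`. -/
def posF (t : lang.Term (α ⊕ Fin n)) : lang.BoundedFormula α n :=
  leF 1 t ⊓ ∼(leF t 1)

/-- The formula "`t` has order `k`" (for `k ≥ 1`). -/
noncomputable def orderF (k : ℕ) (t : lang.Term (α ⊕ Fin n)) : lang.BoundedFormula α n :=
  ((t ^ k) =' 1) ⊓ BoundedFormula.iInf (fun j : Set.Ioo 0 k => ∼((t ^ (j : ℕ)) =' 1))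

end Formulas

/-! ### The theory -/

/-- The axioms of pre-ordered abelian groups. -/
def groupAxioms : lang.Theory :=
  { ∀' ∀' ∀' (((&0 * &1) * &2) =' (&0 * (&1 * &2))),
    ∀' ∀' ((&0 * &1) =' (&1 * &0)),
    ∀' ((&0 * 1) =' &0),
    ∀' ((&0 * (&0)⁻¹) =' 1),
    ∀' (leF &0 &0),
    ∀' ∀' ∀' (leF &0 &1 ⊓ leF &1 &2 ⟹ leF &0 &2),
    ∀' ∀' (leF &0 &1 ⊔ leF &1 &0),
    ∀' ∀' ∀' (leF &0 &1 ⟹ leF (&0 * &2) (&1 * &2)) }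

/-- `P_k` is the subgroup of `k`-th powers. -/
def powAxiom (k : ℕ) (hk : 2 ≤ k) : lang.Sentence :=
  ∀' (powF k hk &0 ⇔ ∃' (((&1) ^ k) =' &0))

/-- There is no element of order `k`. -/
noncomputable def noOrderAxiom (k : ℕ) : lang.Sentence :=
  ∀' ∼(orderF k &0)

/-- The torsion elements (those with `g ^ m = 1`, where `m` is the exponent of `H`) form a group
isomorphic to `H`: they can be enumerated without repetition as `(x h)`, `h ∈ H`, in such a way that
`x (h * k) = x h * x k`. -/
noncomputable def torsionAxiom (H : Type*) [CommGroup H] [Finite H] : lang.Sentence :=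
  let x {n : ℕ} (h : H) : lang.Term ((Empty ⊕ H) ⊕ Fin n) := Term.var (Sum.inl (Sum.inr h))
  Formula.iExs H
    (BoundedFormula.iInf (fun p : H × H => (x (p.1 * p.2)) =' (x p.1 * x p.2)) ⊓
      BoundedFormula.iInf (fun p : {p : H × H // p.1 ≠ p.2} => ∼((x p.1.1) =' (x p.1.2))) ⊓
      (∀' ((((&0) ^ Monoid.exponent H) =' 1) ⇔
        BoundedFormula.iSup (fun h : H => (&0) =' (x h)))) :
      lang.BoundedFormula (Empty ⊕ H) 0)

/-- If `g ∼ 1` then `g` is torsion, i.e. `g ^ m = 1`. -/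
def simAxiom (m : ℕ) : lang.Sentence :=
  ∀' (leF &0 1 ⊓ leF 1 &0 ⟹ ((&0) ^ m) =' 1)

/-- The order is trivial on the torsion subgroup `{g | g ^ m = 1}`. -/
def trivialAxiom (m : ℕ) : lang.Sentence :=
  ∀' ∀' ((((&0) ^ m) =' 1) ⊓ (((&1) ^ m) =' 1) ⟹ leF &0 &1)

/-- `τ` is positive and below every positive element. -/
def leastAxiom : lang.Sentence :=
  posF tauT ⊓ ∀' (posF &0 ⟹ leF tauT &0)

/-- Modulo the torsion subgroup `{g | g ^ m = 1}`, every element is a `k`-th power times one of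
`1, τ, …, τ ^ (k - 1)`. -/
noncomputable def divisionAxiom (m k : ℕ) : lang.Sentence :=
  ∀' ∃' ∃' ((((&2) ^ m) =' 1) ⊓
    BoundedFormula.iSup (fun i : Fin k => (&0) =' (&2 * ((&1) ^ k * tauT ^ (i : ℕ)))))

/-- The theory `T_H` of pre-ordered abelian groups with torsion `H` and ordered Presburger quotient
modulo `H`. Total orderedness of the quotient is the content of `simAxiom` together with
`groupAxioms`. -/
noncomputable def theoryT (H : Type*) [CommGroup H] [Finite H] : lang.Theory :=
  groupAxioms ∪
  {φ | ∃ k hk, φ = powAxiom k hk} ∪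
  {φ | ∃ k, 1 ≤ k ∧ ¬ k ∣ Monoid.exponent H ∧ φ = noOrderAxiom k} ∪
  {torsionAxiom H, simAxiom (Monoid.exponent H), trivialAxiom (Monoid.exponent H), leastAxiom} ∪
  {φ | ∃ k, 2 ≤ k ∧ φ = divisionAxiom (Monoid.exponent H) k}

/-! ### Model-completeness -/

/-- A theory is model-complete if every formula is equivalent, in all models of the theory, to an
existential formula. -/
def IsModelComplete {L : Language} (T : L.Theory) : Prop :=
  ∀ (n : ℕ) (φ : L.Formula (Fin n)), ∃ ψ : L.Formula (Fin n), ψ.IsExistential ∧ φ ⇔[T] ψ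

end FinByPres

/-!
The theory is analysed by a back-and-forth argument with finitely many types at each level, so that
neither compactness nor saturated models are needed.

*The models.* Unravelling the axioms shows that the models of `theoryT H` are the intended
structures (`model_theoryT_iff`, `exists_eq_enrich`). Let `c` enumerate the torsion subgroup of such
a structure `G`, and let `m` be the exponent of `H`. Every `g` is `c k * τ ^ j * z ^ m` for some
`k`, `j`, `z`, and here `k` is unique, since `τ` generates a cyclic group that remains pure modulo
torsion. Thus `g ↦ k` is a retraction onto the torsion subgroup that kills `τ`, and it splits `G` as
the product of `H` and the `ℤ`-group `G ⧸ torsion`, with `τ = (1, t)`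
(`IsPresburgerModulo.hasCoordinates`).

*The back-and-forth.* Two tuples, of one or of two models with such coordinates, are `(K, N)`-similar
if their `H`-coordinates agree, their second coordinates agree modulo `N`, and integral linear forms
with coefficients and constant term at most `K` have the same signs at both (`Coordinates.Sim`). If
`K'` and `N'` are large enough in terms of `K` and `N`, then `(K', N')`-similar tuples can be
extended on both sides to `(K, N)`-similar ones (`Coordinates.Sim.exists_snoc`). This is the
elimination of a quantifier in Presburger arithmetic, in the form of
`IsZGroup.exists_same_position`: a new element either is a small translate of a linear form in the
old ones, and then the same translate works on the other side, or it lies deep in a gap between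
such forms, and then the corresponding gap has elements of all residues. By induction, every formula
is preserved by `(K, N)`-similarity for some `K` and `N` (`Coordinates.exists_realize_iff_of_sim`).

*Model-completeness.* There are only finitely many `(K, N)`-similarity classes, and each is defined
by a quantifier-free formula in which the enumeration `c` occurs as a tuple of parameters; residues
are expressed by the predicates `P_N` (`Coordinates.exists_isQF_sim`). That `c` is an enumeration is
quantifier-free as well, so that guessing `c` turns a formula into an existential one
(`exists_isExistential_iff`).

*Finite-by-Presburger groups.* In a totally pre-ordered group torsion elements are equivalent to `1`,
so if only finitely many elements are, these form the torsion subgroup. Model-completeness of the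
complete theory is inherited from the theory `theoryT H`, which it contains.
-/

namespace FinByPres

/-! ### `ℤ`-groups -/

/-- A `ℤ`-group in additive notation, with `t` as its least positive element. -/
structure IsZGroup {A : Type*} [AddCommGroup A] [LinearOrder A] (t : A) : Prop where
  pos : 0 < t
  least : ∀ a, 0 < a → t ≤ a
  division : ∀ n : ℤ, 0 < n → ∀ a : A, ∃ b : A, ∃ i : ℤ, 0 ≤ i ∧ i < n ∧ a = n • b + i • t

namespace IsZGroup

variable {A : Type*} [AddCommGroup A] [LinearOrder A] [IsOrderedAddMonoid A] {t : A}

/-- The elements between `0` and `k • t` are the multiples of `t`. -/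
theorem exists_zsmul_eq (ht : IsZGroup t) (k : ℕ) :
    ∀ x : A, 0 ≤ x → x ≤ k • t → ∃ s : ℤ, 0 ≤ s ∧ s ≤ k ∧ x = s • t := by
  induction k with
  | zero =>
    intro x h0 h1
    exact ⟨0, le_rfl, by simp, by rw [zero_smul] at *; exact le_antisymm h1 h0⟩
  | succ k ih =>
    intro x h0 h1
    rcases h0.eq_or_lt with rfl | h
    · exact ⟨0, le_rfl, by positivity, by simp⟩
    · obtain ⟨s, hs0, hs1, hs⟩ := ih (x - t) (sub_nonneg.2 (ht.least _ h))
        (sub_le_iff_le_add.2 (by rwa [succ_nsmul] at h1))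
      refine ⟨s + 1, by omega, by push_cast; omega, ?_⟩
      rw [add_smul, ← hs, one_smul, sub_add_cancel]

theorem zsmul_le_zsmul_iff (ht : IsZGroup t) {a b : ℤ} : a • t ≤ b • t ↔ a ≤ b :=
  zsmul_le_zsmul_iff_left ht.pos

theorem dvd_of_zsmul_eq (ht : IsZGroup t) {n : ℤ} (hn : 0 < n) {k : ℤ} {b : A}
    (h : n • b = k • t) : n ∣ k := by
  have hr0 := Int.emod_nonneg k hn.ne'
  have hr1 := Int.emod_lt_of_pos k hn
  have hk : n • (b - (k / n) • t) = (k % n) • t := by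
    rw [smul_sub, h, smul_smul, ← sub_smul]
    congr 1
    have := Int.emod_add_mul_ediv k n
    omega
  rw [Int.dvd_iff_emod_eq_zero]
  rcases le_or_gt (b - (k / n) • t) 0 with hy | hy
  · have h1 : (k % n) • t ≤ (0 : ℤ) • t := by
      rw [← hk, zero_smul]
      exact smul_nonpos_of_nonneg_of_nonpos hn.le hy
    exact le_antisymm (ht.zsmul_le_zsmul_iff.1 h1) hr0
  · have h1 : n • t ≤ (k % n) • t := by
      rw [← hk]
      exact zsmul_le_zsmul_right hn.le (ht.least _ hy)
    have := ht.zsmul_le_zsmul_iff.1 h1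
    omega

variable {A' : Type*} [AddCommGroup A'] [LinearOrder A'] [IsOrderedAddMonoid A'] {t' : A'}

/-- One step of the back-and-forth between `ℤ`-groups. The elements of `U` are linear forms, which
`f` and `f'` evaluate in the two groups; `e` is the constant form `1`. If the differences of forms
in `U` have the same signs on both sides, up to shifts by `2 * (L * N)`, and the forms in `U` have
the same residues modulo `L * N`, then for each `a` there is a `b` of the same residue modulo `N`
such that `L • b` is in the same position relative to `U` as `L • a`. -/
theorem exists_same_position (ht : IsZGroup t) (ht' : IsZGroup t') {D : Type*} [AddCommGroup D]
    {e : D} {f : D →+ A} {f' : D →+ A'} (hf : f e = t) (hf' : f' e = t') {U : Set D}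
    (hU : U.Finite) (h0 : 0 ∈ U) {L N : ℤ} (hL : 0 < L) (hN : 0 < N)
    (hsign : ∀ u ∈ U, ∀ v ∈ U, ∀ s : ℤ, |s| ≤ 2 * (L * N) →
      (f (u - v + s • e) ≤ 0 ↔ f' (u - v + s • e) ≤ 0))
    (hres : ∀ u ∈ U, ∃ k : ℤ, (∃ z, f u = k • t + (L * N) • z) ∧
      ∃ z', f' u = k • t' + (L * N) • z') (a : A) :
    ∃ b : A', (∃ j : ℤ, (∃ z, a = j • t + N • z) ∧ ∃ z', b = j • t' + N • z') ∧
      ∀ u ∈ U, (L • a ≤ f u ↔ L • b ≤ f' u) ∧ (f u ≤ L • a ↔ f' u ≤ L • b) := by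
  have hLN : 0 < L * N := mul_pos hL hN
  have hle : ∀ u ∈ U, ∀ v ∈ U, ∀ s : ℤ, |s| ≤ 2 * (L * N) →
      (f u + s • t ≤ f v ↔ f' u + s • t' ≤ f' v) := by
    intro u hu v hv s hs
    have := hsign u hu v hv s hs
    simp only [map_add, map_sub, map_zsmul, hf, hf'] at this
    rw [← sub_nonpos, ← sub_nonpos (b := f' v), add_sub_right_comm, this, add_sub_right_comm]
  obtain ⟨z, j, -, -, hj⟩ := ht.division N hN a
  rw [add_comm] at hj
  by_cases hclose : ∃ u ∈ U, ∃ s : ℤ, |s| ≤ L * N ∧ L • a = f u + s • t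
  · -- `L • a` is close to some `u`: the same shift of `u` is divisible by `L` on the other side.
    obtain ⟨u, hu, s, hs, has⟩ := hclose
    obtain ⟨k, ⟨w, hw⟩, ⟨w', hw'⟩⟩ := hres u hu
    have hdvd : L * N ∣ k + s - L * j := by
      refine ht.dvd_of_zsmul_eq hLN (b := z - w) ?_
      rw [hj, hw] at has
      have h2 : (L * j) • t + (L * N) • z = k • t + (L * N) • w + s • t := by
        rw [← has, smul_add, smul_smul, smul_smul]
      rw [smul_sub, sub_smul, add_smul, sub_eq_sub_iff_add_eq_add, add_comm _ ((L * j) • t), h2]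
      abel
    obtain ⟨q, hq⟩ := hdvd
    have hb : L • (j • t' + N • (q • t' + w')) = f' u + s • t' := by
      have : k + s = L * j + L * N * q := by linarith
      rw [hw', smul_add, smul_add, smul_add, smul_smul, smul_smul, smul_smul, smul_smul,
        add_right_comm, ← add_smul, this, add_smul, add_assoc, mul_assoc]
    refine ⟨j • t' + N • (q • t' + w'), ⟨j, ⟨z, hj⟩, ⟨_, rfl⟩⟩, fun v hv => ?_⟩
    rw [hb, has]
    refine ⟨hle u hu v hv s (by linarith), ?_⟩
    have := hle v hv u hu (-s) (by rw [abs_neg]; linarith)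
    rwa [neg_smul, neg_smul, ← sub_eq_add_neg, ← sub_eq_add_neg, sub_le_iff_le_add,
      sub_le_iff_le_add] at this
  · -- `L • a` lies far from every `u`: any element of the right residue in the gap will do.
    push Not at hclose
    have hlow : ∀ u ∈ U, f u ≤ L • a → f u + (L * N) • t < L • a := by
      intro u hu h
      by_contra! hcon
      obtain ⟨s, hs0, hs1, hs⟩ := ht.exists_zsmul_eq (L * N).toNat (L • a - f u)
        (sub_nonneg.2 h) (by
          rw [← natCast_zsmul, Int.toNat_of_nonneg hLN.le]
          exact sub_le_iff_le_add'.2 hcon)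
      rw [Int.toNat_of_nonneg hLN.le] at hs1
      exact hclose u hu s (by rwa [abs_of_nonneg hs0]) (by rw [← hs]; abel)
    have hupp : ∀ u ∈ U, L • a ≤ f u → L • a + (L * N) • t < f u := by
      intro u hu h
      by_contra! hcon
      obtain ⟨s, hs0, hs1, hs⟩ := ht.exists_zsmul_eq (L * N).toNat (f u - L • a)
        (sub_nonneg.2 h) (by
          rw [← natCast_zsmul, Int.toNat_of_nonneg hLN.le]
          exact sub_le_iff_le_add'.2 hcon)
      rw [Int.toNat_of_nonneg hLN.le] at hs1
      exact hclose u hu (-s) (by rwa [abs_neg, abs_of_nonneg hs0]) (by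
        rw [neg_smul, ← hs]; abel)
    have htp : 0 < (L * N) • t := smul_pos hLN ht.pos
    have htp' : 0 < (L * N) • t' := smul_pos hLN ht'.pos
    -- It suffices to place `L • b` strictly between the lower and the upper forms.
    suffices H : ∃ b z', b = j • t' + N • z' ∧ (∀ u ∈ U, f u ≤ L • a → f' u < L • b) ∧
        ∀ u ∈ U, L • a ≤ f u → L • b < f' u by
      obtain ⟨b, z', hb, h1, h2⟩ := H
      refine ⟨b, ⟨j, ⟨z, hj⟩, ⟨z', hb⟩⟩, fun u hu => ?_⟩
      rcases le_total (f u) (L • a) with h | h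
      · have h3 : ¬ L • a ≤ f u := fun h4 => by
          have := (hlow u hu h).trans_le h4
          exact absurd this (not_lt.2 (le_add_of_nonneg_right htp.le))
        exact ⟨iff_of_false h3 (h1 u hu h).not_ge, iff_of_true h (h1 u hu h).le⟩
      · have h3 : ¬ f u ≤ L • a := fun h4 => by
          have := (hupp u hu h).trans_le h4
          exact absurd this (not_lt.2 (le_add_of_nonneg_right htp.le))
        exact ⟨iff_of_true h (h2 u hu h).le, iff_of_false h3 (h2 u hu h).not_ge⟩
    have hgap : ∀ u ∈ U, ∀ v ∈ U, f u ≤ L • a → L • a ≤ f v →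
        f' u + (L * N) • t' + (L * N) • t' ≤ f' v := by
      intro u hu v hv h1 h2
      have h3 := (hle u hu v hv (2 * (L * N)) (by rw [abs_of_nonneg (by positivity)])).1 (by
        have := add_lt_add_left (hlow u hu h1) ((L * N) • t)
        rw [two_mul, add_smul, ← add_assoc]
        exact (this.trans (hupp v hv h2)).le)
      rwa [two_mul, add_smul, ← add_assoc] at h3
    -- Every element has, within `L * N` steps above or below, one of the form `L • b` with `b` of
    -- residue `j` modulo `N`.
    have hround : ∀ x : A', ∃ z' : A', ∃ i : ℤ, 0 ≤ i ∧ i < L * N ∧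
        x = L • (j • t' + N • z') + i • t' := by
      intro x
      obtain ⟨z', i, hi0, hi1, hi⟩ := ht'.division (L * N) hLN (x - (L * j) • t')
      refine ⟨z', i, hi0, hi1, ?_⟩
      rw [smul_add, smul_smul, smul_smul, add_assoc, ← hi]
      abel
    by_cases hne : ∃ u ∈ U, f u ≤ L • a
    · obtain ⟨u, ⟨hu, hua⟩, hmax⟩ := Set.exists_max_image {u ∈ U | f u ≤ L • a} f'
        (hU.subset (Set.sep_subset _ _)) hne
      obtain ⟨z', i, hi0, hi1, hi⟩ := hround (f' u)
      have hb : L • (j • t' + N • (z' + t')) = f' u + (L * N - i) • t' := by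
        rw [hi, smul_add N, ← add_assoc, smul_add L (_ + _), smul_smul, sub_smul]
        abel
      refine ⟨_, z' + t', rfl, fun v hv hva => ?_, fun v hv hva => ?_⟩
      · rw [hb]
        exact (hmax v ⟨hv, hva⟩).trans_lt (lt_add_of_pos_right _ (smul_pos (by omega) ht'.pos))
      · rw [hb]
        refine lt_of_lt_of_le ?_ (hgap u hu v hv hua hva)
        have hi' : L * N - i ≤ L * N := by omega
        refine (add_le_add_right (ht'.zsmul_le_zsmul_iff.2 hi') _).trans_lt
          (lt_add_of_pos_right _ htp')
    · push Not at hne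
      obtain ⟨u, hu, hmin⟩ := Set.exists_min_image U f' hU ⟨0, h0⟩
      obtain ⟨z', i, hi0, hi1, hi⟩ := hround (f' u)
      have hb : L • (j • t' + N • (z' - t')) = f' u - (L * N + i) • t' := by
        rw [hi, smul_sub N, ← add_sub_assoc, smul_sub L (_ + _), smul_smul, add_smul]
        abel
      refine ⟨_, z' - t', rfl, fun v hv hva => absurd hva (hne v hv).not_ge, fun v hv _ => ?_⟩
      rw [hb]
      exact (sub_lt_self _ (smul_pos (by omega) ht'.pos)).trans_le (hmin v hv)

end IsZGroup

/-! ### Coordinates and similarity of tuples -/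

/-- Coordinates that present a structure `M` as the product of the group `H` and the `ℤ`-group `A`
(additive, with least positive element `t`): the order is that of the second coordinate, and `τ` is
the point `(1, t)`. -/
structure Coordinates (H : Type*) [CommGroup H] (M : Type*) [lang.Structure M] (A : Type*)
    [AddCommGroup A] [LinearOrder A] where
  t : A
  isZGroup : IsZGroup t
  h : M → H
  q : M → A
  ext : ∀ x y, h x = h y → q x = q y → x = y
  surj : ∀ k a, ∃ x, h x = k ∧ q x = a
  h_one : ∀ v, h (Structure.funMap (L := lang) Func.one v) = 1
  q_one : ∀ v, q (Structure.funMap (L := lang) Func.one v) = 0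
  h_tau : ∀ v, h (Structure.funMap (L := lang) Func.tau v) = 1
  q_tau : ∀ v, q (Structure.funMap (L := lang) Func.tau v) = t
  h_inv : ∀ v, h (Structure.funMap (L := lang) Func.inv v) = (h (v 0))⁻¹
  q_inv : ∀ v, q (Structure.funMap (L := lang) Func.inv v) = -q (v 0)
  h_mul : ∀ v, h (Structure.funMap (L := lang) Func.mul v) = h (v 0) * h (v 1)
  q_mul : ∀ v, q (Structure.funMap (L := lang) Func.mul v) = q (v 0) + q (v 1)
  le_iff : ∀ v, Structure.RelMap (L := lang) Rel.le v ↔ q (v 0) ≤ q (v 1)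
  pow_iff : ∀ n hn v, Structure.RelMap (L := lang) (Rel.pow n hn) v ↔
    (∃ k, k ^ n = h (v 0)) ∧ ∃ b, (n : ℤ) • b = q (v 0)

namespace Coordinates

variable {H : Type*} [CommGroup H]
  {M : Type*} [lang.Structure M] {A : Type*} [AddCommGroup A] [LinearOrder A]
  {M' : Type*} [lang.Structure M'] {A' : Type*} [AddCommGroup A'] [LinearOrder A']
  {ι : Type*} [Fintype ι]

/-- The value at the tuple `x` of the linear form with coefficients `d.1` and constant term `d.2`:
`∑ i, d.1 i • q (x i) + d.2 • t`. -/
def lin (C : Coordinates H M A) (x : ι → M) : (ι → ℤ) × ℤ →+ A where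
  toFun d := ∑ i, d.1 i • C.q (x i) + d.2 • C.t
  map_zero' := by simp
  map_add' d d' := by
    simp only [Prod.fst_add, Prod.snd_add, Pi.add_apply, add_smul, Finset.sum_add_distrib]
    abel

theorem lin_apply (C : Coordinates H M A) (x : ι → M) (d : (ι → ℤ) × ℤ) :
    C.lin x d = ∑ i, d.1 i • C.q (x i) + d.2 • C.t := rfl

/-- The second coordinate of the value of a term is a linear form, the same in all models. -/
theorem exists_lin_eq_realize (s : lang.Term ι) :
    ∃ d : (ι → ℤ) × ℤ, ∀ {H : Type*} [CommGroup H] {M : Type*} [lang.Structure M] {A : Type*}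
      [AddCommGroup A] [LinearOrder A] (C : Coordinates H M A) (x : ι → M),
      C.q (s.realize x) = C.lin x d := by
  classical
  induction s with
  | var i =>
    refine ⟨(Pi.single i 1, 0), fun C x => ?_⟩
    rw [lin_apply, Finset.sum_eq_single i] <;> simp +contextual
  | func f ts ih =>
    choose d hd using ih
    cases f with
    | one => exact ⟨0, fun C x => by rw [Term.realize_func, C.q_one, map_zero]⟩
    | tau => exact ⟨(0, 1), fun C x => by rw [Term.realize_func, C.q_tau]; simp [lin_apply]⟩
    | inv => exact ⟨-d 0, fun C x => by rw [Term.realize_func, C.q_inv, hd, map_neg]⟩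
    | mul => exact ⟨d 0 + d 1, fun C x => by rw [Term.realize_func, C.q_mul, hd, hd, map_add]⟩

omit [Fintype ι] in
theorem h_realize_eq (C : Coordinates H M A) (C' : Coordinates H M' A') {x : ι → M} {y : ι → M'}
    (hxy : ∀ i, C.h (x i) = C'.h (y i)) (s : lang.Term ι) :
    C.h (s.realize x) = C'.h (s.realize y) := by
  induction s with
  | var i => exact hxy i
  | func f ts ih =>
    cases f with
    | one => rw [Term.realize_func, Term.realize_func, C.h_one, C'.h_one]
    | tau => rw [Term.realize_func, Term.realize_func, C.h_tau, C'.h_tau]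
    | inv => rw [Term.realize_func, Term.realize_func, C.h_inv, C'.h_inv, ih]
    | mul => rw [Term.realize_func, Term.realize_func, C.h_mul, C'.h_mul, ih, ih]

/-- Two tuples, possibly of different models, are `(K, N)`-similar if their `H`-coordinates agree,
their second coordinates agree modulo `N`, and the linear forms with coefficients and constant term
in `[-K, K]` (that is, of sup norm at most `K`) have the same signs at both. -/
structure Sim (C : Coordinates H M A) (C' : Coordinates H M' A') (K : ℕ) (N : ℤ)
    (x : ι → M) (y : ι → M') : Prop where
  h_eq : ∀ i, C.h (x i) = C'.h (y i)
  res : ∀ i, ∃ k : ℤ, (∃ z, C.q (x i) = k • C.t + N • z) ∧ ∃ z, C'.q (y i) = k • C'.t + N • z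
  sign : ∀ d : (ι → ℤ) × ℤ, ‖d‖ ≤ K → (C.lin x d ≤ 0 ↔ C'.lin y d ≤ 0)

variable {C : Coordinates H M A} {C' : Coordinates H M' A'} {K : ℕ} {N : ℤ} {x : ι → M} {y : ι → M'}

theorem Sim.symm (h : Sim C C' K N x y) : Sim C' C K N y x where
  h_eq i := (h.h_eq i).symm
  res i := (h.res i).imp fun _ => And.symm
  sign d hd := (h.sign d hd).symm

theorem Sim.mono {K₀ : ℕ} {N₀ : ℤ} (h : Sim C C' K N x y) (hK : K₀ ≤ K) (hN : N₀ ∣ N) :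
    Sim C C' K₀ N₀ x y where
  h_eq := h.h_eq
  res i := by
    obtain ⟨c, rfl⟩ := hN
    obtain ⟨k, ⟨z, hz⟩, ⟨z', hz'⟩⟩ := h.res i
    exact ⟨k, ⟨c • z, by rw [hz, smul_smul]⟩, ⟨c • z', by rw [hz', smul_smul]⟩⟩
  sign d hd := h.sign d (hd.trans (Nat.cast_le.2 hK))

theorem Sim.res_lin (h : Sim C C' K N x y) (d : (ι → ℤ) × ℤ) :
    ∃ k : ℤ, (∃ z, C.lin x d = k • C.t + N • z) ∧ ∃ z, C'.lin y d = k • C'.t + N • z := by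
  choose k hz hz' using h.res
  choose z hz using hz
  choose z' hz' using hz'
  refine ⟨∑ i, d.1 i * k i + d.2, ⟨∑ i, d.1 i • z i, ?_⟩, ∑ i, d.1 i • z' i, ?_⟩
  · simp only [lin_apply, hz, smul_add, Finset.sum_add_distrib, add_smul, Finset.sum_smul,
      Finset.smul_sum, smul_smul, mul_comm N]
    abel
  · simp only [lin_apply, hz', smul_add, Finset.sum_add_distrib, add_smul, Finset.sum_smul,
      Finset.smul_sum, smul_smul, mul_comm N]
    abel

variable [IsOrderedAddMonoid A] [IsOrderedAddMonoid A']

theorem Sim.sign_ge (h : Sim C C' K N x y) {d : (ι → ℤ) × ℤ} (hd : ‖d‖ ≤ K) :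
    0 ≤ C.lin x d ↔ 0 ≤ C'.lin y d := by
  have := h.sign (-d) (by rwa [norm_neg])
  rwa [map_neg, map_neg, neg_nonpos, neg_nonpos] at this

omit [IsOrderedAddMonoid A'] in
theorem Sim.dvd_lin (h : Sim C C' K N x y) (hN : 0 < N) {d : (ι → ℤ) × ℤ}
    (hd : ∃ b, N • b = C.lin x d) : ∃ b, N • b = C'.lin y d := by
  obtain ⟨k, ⟨z, hz⟩, ⟨z', hz'⟩⟩ := h.res_lin d
  obtain ⟨b, hb⟩ := hd
  obtain ⟨c, rfl⟩ := C.isZGroup.dvd_of_zsmul_eq hN (k := k) (b := b - z) (by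
    rw [smul_sub, hb, hz, add_sub_cancel_right])
  exact ⟨c • C'.t + z', by rw [hz', smul_add, smul_smul]⟩

section Extension

variable {α : Type*} [Fintype α] {n : ℕ}

omit [IsOrderedAddMonoid A] in
theorem lin_snoc (C : Coordinates H M A) (v : α → M) (xs : Fin n → M) (a : M)
    (d : (α ⊕ Fin (n + 1) → ℤ) × ℤ) :
    C.lin (Sum.elim v (Fin.snoc xs a : Fin (n + 1) → M)) d =
      C.lin (Sum.elim v xs) (d.1 ∘ Sum.map id Fin.castSucc, d.2) +
        d.1 (Sum.inr (Fin.last n)) • C.q a := by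
  simp only [lin_apply, Fintype.sum_sum_type, Fin.sum_univ_castSucc, Sum.elim_inl, Sum.elim_inr,
    Fin.snoc_castSucc, Fin.snoc_last, Function.comp_apply, Sum.map_inl, Sum.map_inr, id_eq]
  abel

open scoped Nat in
/-- Back-and-forth: sufficiently similar tuples remain similar after a suitable extension. With
`L = K!`, a condition comparing `c • a`, where `0 < |c| ≤ K`, with a form of norm at most `K`
becomes one comparing `L • a` with a form of norm at most `L * K`; differences of two such forms,
shifted by at most `2 * (L * N)`, have norm at most `2 * L * (K + N)`. -/
theorem Sim.exists_snoc (hN : 0 < N) {v : α → M} {xs : Fin n → M} {w : α → M'} {ys : Fin n → M'}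
    (h : Sim C C' (2 * K ! * (K + N.toNat)) (K ! * N) (Sum.elim v xs) (Sum.elim w ys)) (a : M) :
    ∃ b : M', Sim C C' K N (Sum.elim v (Fin.snoc xs a : Fin (n + 1) → M))
      (Sum.elim w (Fin.snoc ys b : Fin (n + 1) → M')) := by
  have hL : (0 : ℤ) < (K ! : ℤ) := by exact_mod_cast Nat.factorial_pos K
  have hL1 : (1 : ℝ) ≤ (K ! : ℝ) := by exact_mod_cast Nat.factorial_pos K
  have hNR : ((N.toNat : ℕ) : ℝ) = (N : ℝ) := by exact_mod_cast Int.toNat_of_nonneg hN.le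
  have hNR0 : (0 : ℝ) < N := by exact_mod_cast hN
  have hKR0 : (0 : ℝ) ≤ K := K.cast_nonneg
  let e : (α ⊕ Fin n → ℤ) × ℤ := (0, 1)
  have he : ‖e‖ = 1 := by simp [e, Prod.norm_def]
  obtain ⟨b, hb, hpos⟩ := C.isZGroup.exists_same_position C'.isZGroup (e := e)
    (f := C.lin (Sum.elim v xs)) (f' := C'.lin (Sum.elim w ys))
    (by simp [e, lin_apply]) (by simp [e, lin_apply]) (U := Metric.closedBall 0 (K ! * K))
    ((isCompact_closedBall _ _).finite_of_discrete) (by simp; positivity) hL hN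
    (by
      intro u hu u' hu' s hs
      rw [mem_closedBall_zero_iff] at hu hu'
      refine h.sign _ ?_
      have hs' : |(s : ℝ)| ≤ 2 * (K ! * N) := by exact_mod_cast hs
      have h1 : ‖s • e‖ ≤ 2 * (K ! * N) := by
        refine (norm_zsmul_le s e).trans ?_
        rw [he, mul_one, Int.norm_eq_abs]
        exact hs'
      have h2 := norm_add_le (u - u') (s • e)
      have h3 := norm_sub_le u u'
      push_cast
      rw [hNR]
      linarith)
    (fun u _ => h.res_lin u) (C.q a)
  obtain ⟨b', hb'h, hb'q⟩ := C'.surj (C.h a) b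
  subst hb'q
  refine ⟨b', ⟨?_, ?_, ?_⟩⟩
  · rintro (i | i)
    · exact h.h_eq (Sum.inl i)
    · refine Fin.lastCases ?_ (fun i => ?_) i
      · simpa using hb'h.symm
      · simpa using h.h_eq (Sum.inr i)
  · have h' := h.mono (K₀ := K) (N₀ := N) (by
      have := Nat.factorial_pos K
      nlinarith) (dvd_mul_left _ _)
    rintro (i | i)
    · exact h'.res (Sum.inl i)
    · refine Fin.lastCases ?_ (fun i => ?_) i
      · simpa using hb
      · simpa using h'.res (Sum.inr i)
  · intro d hd
    rw [lin_snoc, lin_snoc]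
    set c := d.1 (Sum.inr (Fin.last n)) with hc
    set d₀ : (α ⊕ Fin n → ℤ) × ℤ := (d.1 ∘ Sum.map id Fin.castSucc, d.2) with hd₀
    have hd1 : ‖d.1‖ ≤ K := (norm_fst_le d).trans hd
    have hcK : |(c : ℝ)| ≤ K := by
      rw [← Int.norm_eq_abs]
      exact (norm_le_pi_norm d.1 _).trans hd1
    have hd₀K : ‖d₀‖ ≤ K := by
      refine max_le ((pi_norm_le_iff_of_nonneg hKR0).2 fun i => ?_) ((norm_snd_le d).trans hd)
      exact (norm_le_pi_norm d.1 _).trans hd1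
    have hdvd : ∀ c' : ℤ, 0 < c' → (c' : ℝ) ≤ K → ∃ m : ℤ, 0 < m ∧ (K ! : ℤ) = c' * m ∧
        ‖m • d₀‖ ≤ K ! * K := by
      intro c' hc0 hcK
      have hcK' : c' ≤ K := by exact_mod_cast hcK
      obtain ⟨m, hm⟩ : c' ∣ (K ! : ℤ) := by
        lift c' to ℕ using hc0.le
        exact_mod_cast Nat.dvd_factorial (by exact_mod_cast hc0) (by exact_mod_cast hcK')
      have hm0 : 0 < m := pos_of_mul_pos_right (hm ▸ hL) hc0.le
      refine ⟨m, hm0, hm, (norm_zsmul_le m d₀).trans ?_⟩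
      have hmL : m ≤ (K ! : ℤ) := by rw [hm]; nlinarith
      have hmL' : (m : ℝ) ≤ (K ! : ℝ) := by exact_mod_cast hmL
      rw [Int.norm_eq_abs, abs_of_pos (by exact_mod_cast hm0)]
      exact mul_le_mul hmL' hd₀K (norm_nonneg _) (by positivity)
    rcases lt_trichotomy c 0 with hc0 | hc0 | hc0
    · obtain ⟨m, hm0, hm, hmd⟩ := hdvd (-c) (by omega) (by
        push_cast
        exact (neg_le_abs _).trans hcK)
      have key := (hpos (m • d₀) (by rwa [mem_closedBall_zero_iff])).2
      rwa [map_zsmul, map_zsmul, hm, mul_comm, mul_smul, mul_smul,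
        zsmul_le_zsmul_iff_right hm0, zsmul_le_zsmul_iff_right hm0, neg_smul, neg_smul,
        ← sub_nonpos, sub_neg_eq_add, ← sub_nonpos (b := -(c • C'.q b')), sub_neg_eq_add] at key
    · rw [hc0, zero_smul, zero_smul, add_zero, add_zero]
      refine h.sign _ (hd₀K.trans ?_)
      push_cast
      rw [hNR]
      nlinarith
    · obtain ⟨m, hm0, hm, hmd⟩ := hdvd c hc0 ((le_abs_self _).trans hcK)
      have key := (hpos (-(m • d₀)) (by rwa [mem_closedBall_zero_iff, norm_neg])).1
      rwa [map_neg, map_neg, map_zsmul, map_zsmul, hm, mul_comm, mul_smul, mul_smul, ← smul_neg,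
        ← smul_neg, zsmul_le_zsmul_iff_right hm0, zsmul_le_zsmul_iff_right hm0,
        le_neg_iff_add_nonpos_left, le_neg_iff_add_nonpos_left] at key

end Extension

omit [Fintype ι] [IsOrderedAddMonoid A] [IsOrderedAddMonoid A'] in
theorem eq_iff (C : Coordinates H M A) {x y : M} : x = y ↔ C.h x = C.h y ∧ C.q x = C.q y :=
  ⟨fun h => by simp [h], fun h => C.ext x y h.1 h.2⟩

universe u v w a

/-- Similarity of a high enough degree preserves the truth of a given formula. -/
theorem exists_realize_iff_of_sim {α : Type a} [Fintype α] {n : ℕ} (φ : lang.BoundedFormula α n) :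
    ∃ (K : ℕ) (N : ℤ), 0 < N ∧ ∀ {H : Type w} [CommGroup H] {M M' : Type u}
      [lang.Structure M] [lang.Structure M'] {A A' : Type v}
      [AddCommGroup A] [LinearOrder A] [IsOrderedAddMonoid A]
      [AddCommGroup A'] [LinearOrder A'] [IsOrderedAddMonoid A']
      (C : Coordinates H M A) (C' : Coordinates H M' A')
      (v : α → M) (xs : Fin n → M) (w : α → M') (ys : Fin n → M'),
      Sim C C' K N (Sum.elim v xs) (Sum.elim w ys) → (φ.Realize v xs ↔ φ.Realize w ys) := by
  induction φ with
  | falsum => exact ⟨0, 1, one_pos, fun _ _ _ _ _ _ _ => Iff.rfl⟩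
  | equal s₁ s₂ =>
    obtain ⟨d₁, hd₁⟩ := exists_lin_eq_realize s₁
    obtain ⟨d₂, hd₂⟩ := exists_lin_eq_realize s₂
    obtain ⟨K, hK⟩ := exists_nat_ge ‖d₁ - d₂‖
    refine ⟨K, 1, one_pos, fun C C' v xs w ys h => ?_⟩
    have h1 := h.sign _ hK
    have h2 := h.sign_ge hK
    simp only [map_sub, sub_nonpos, sub_nonneg] at h1 h2
    simp only [BoundedFormula.Realize]
    rw [C.eq_iff, C'.eq_iff, hd₁, hd₂, hd₁, hd₂, h_realize_eq C C' h.h_eq, h_realize_eq C C' h.h_eq,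
      le_antisymm_iff (a := C.lin _ d₁), le_antisymm_iff (a := C'.lin _ d₁), h1, h2]
  | rel R ts =>
    cases R with
    | le =>
      obtain ⟨d₁, hd₁⟩ := exists_lin_eq_realize (ts 0)
      obtain ⟨d₂, hd₂⟩ := exists_lin_eq_realize (ts 1)
      obtain ⟨K, hK⟩ := exists_nat_ge ‖d₁ - d₂‖
      refine ⟨K, 1, one_pos, fun C C' v xs w ys h => ?_⟩
      have h1 := h.sign _ hK
      simp only [map_sub, sub_nonpos] at h1
      rw [BoundedFormula.Realize, BoundedFormula.Realize, C.le_iff, C'.le_iff, hd₁, hd₂, hd₁, hd₂,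
        h1]
    | pow k hk =>
      obtain ⟨d, hd⟩ := exists_lin_eq_realize (ts 0)
      refine ⟨0, k, by omega, fun C C' v xs w ys h => ?_⟩
      rw [BoundedFormula.Realize, BoundedFormula.Realize, C.pow_iff, C'.pow_iff, hd, hd,
        h_realize_eq C C' h.h_eq]
      exact and_congr_right fun _ =>
        ⟨h.dvd_lin (by omega), h.symm.dvd_lin (by omega)⟩
  | imp φ ψ ihφ ihψ =>
    obtain ⟨K₁, N₁, hN₁, h₁⟩ := ihφ
    obtain ⟨K₂, N₂, hN₂, h₂⟩ := ihψ
    refine ⟨max K₁ K₂, N₁ * N₂, mul_pos hN₁ hN₂, fun C C' v xs w ys h => ?_⟩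
    rw [BoundedFormula.realize_imp, BoundedFormula.realize_imp,
      h₁ C C' v xs w ys (h.mono (le_max_left _ _) (dvd_mul_right _ _)),
      h₂ C C' v xs w ys (h.mono (le_max_right _ _) (dvd_mul_left _ _))]
  | all φ ih =>
    obtain ⟨K, N, hN, ih⟩ := ih
    refine ⟨2 * K.factorial * (K + N.toNat), K.factorial * N,
      mul_pos (Nat.cast_pos.2 K.factorial_pos) hN, fun C C' v xs w ys h => ?_⟩
    rw [BoundedFormula.realize_all, BoundedFormula.realize_all]
    constructor
    · intro H b
      obtain ⟨a, ha⟩ := h.symm.exists_snoc hN b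
      exact (ih C C' v _ w _ ha.symm).1 (H a)
    · intro H a
      obtain ⟨b, hb⟩ := h.exists_snoc hN a
      exact (ih C C' v _ w _ hb).2 (H b)

end Coordinates

/-! ### Existential formulas -/

section Complexity

variable {L : Language} {α β : Type*} {n : ℕ}

theorem isQF_iInf [Finite β] {f : β → L.BoundedFormula α n} (h : ∀ b, (f b).IsQF) :
    (BoundedFormula.iInf f).IsQF := by
  rw [BoundedFormula.iInf]
  induction (@Finset.univ β (Fintype.ofFinite β)).toList with
  | nil => exact BoundedFormula.IsQF.top
  | cons b l ih => exact (h b).inf ih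

theorem isQF_iSup [Finite β] {f : β → L.BoundedFormula α n} (h : ∀ b, (f b).IsQF) :
    (BoundedFormula.iSup f).IsQF := by
  rw [BoundedFormula.iSup]
  induction (@Finset.univ β (Fintype.ofFinite β)).toList with
  | nil => exact BoundedFormula.isQF_bot
  | cons b l ih => exact (h b).sup ih

theorem isExistential_exs {φ : L.BoundedFormula α n} (h : φ.IsExistential) :
    BoundedFormula.IsExistential φ.exs := by
  induction n with
  | zero => exact h
  | succ n ih => exact ih h.ex

theorem isExistential_iExs [Finite β] {φ : L.Formula (α ⊕ β)} (h : φ.IsQF) :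
    BoundedFormula.IsExistential (Formula.iExs β φ) :=
  isExistential_exs (h.relabel _).isExistential

end Complexity

namespace Coordinates

universe u v w

variable {H : Type*} [CommGroup H]
  {M : Type*} [lang.Structure M] {A : Type*} [AddCommGroup A] [LinearOrder A]
  {M' : Type*} [lang.Structure M'] {A' : Type*} [AddCommGroup A'] [LinearOrder A']
  {ι : Type*}

theorem h_realize_mul (C : Coordinates H M A) (x : ι → M) (r s : lang.Term ι) :
    C.h ((r * s).realize x) = C.h (r.realize x) * C.h (s.realize x) := C.h_mul _

theorem q_realize_mul (C : Coordinates H M A) (x : ι → M) (r s : lang.Term ι) :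
    C.q ((r * s).realize x) = C.q (r.realize x) + C.q (s.realize x) := C.q_mul _

theorem h_realize_inv (C : Coordinates H M A) (x : ι → M) (s : lang.Term ι) :
    C.h (s⁻¹.realize x) = (C.h (s.realize x))⁻¹ := C.h_inv _

theorem q_realize_inv (C : Coordinates H M A) (x : ι → M) (s : lang.Term ι) :
    C.q (s⁻¹.realize x) = -C.q (s.realize x) := C.q_inv _

theorem q_realize_one (C : Coordinates H M A) (x : ι → M) :
    C.q ((1 : lang.Term ι).realize x) = 0 := C.q_one _

theorem h_realize_tau_pow (C : Coordinates H M A) (x : ι → M) (j : ℕ) :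
    C.h ((tauT ^ j : lang.Term ι).realize x) = 1 := by
  induction j with
  | zero => exact C.h_one _
  | succ j ih =>
    refine (C.h_realize_mul x (tauT ^ j) tauT).trans ?_
    rw [ih, one_mul]
    exact C.h_tau _

theorem q_realize_tau_pow (C : Coordinates H M A) (x : ι → M) (j : ℕ) :
    C.q ((tauT ^ j : lang.Term ι).realize x) = (j : ℤ) • C.t := by
  induction j with
  | zero => exact (C.q_one _).trans (by simp)
  | succ j ih =>
    refine (C.q_realize_mul x (tauT ^ j) tauT).trans ?_
    rw [ih, Nat.cast_succ, add_smul, one_smul]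
    exact congrArg _ (C.q_tau _)

/-- Every linear form is the second coordinate of the value of a term. -/
theorem exists_realize_eq_lin [Fintype ι] (d : (ι → ℤ) × ℤ) :
    ∃ s : lang.Term ι, ∀ {H : Type u} [CommGroup H] {M : Type v} [lang.Structure M] {A : Type w}
      [AddCommGroup A] [LinearOrder A] (C : Coordinates H M A) (x : ι → M),
      C.q (s.realize x) = C.lin x d := by
  classical
  let S : AddSubgroup ((ι → ℤ) × ℤ) :=
    { carrier := {d | ∃ s : lang.Term ι, ∀ {H : Type u} [CommGroup H] {M : Type v}
        [lang.Structure M] {A : Type w} [AddCommGroup A] [LinearOrder A] (C : Coordinates H M A)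
        (x : ι → M), C.q (s.realize x) = C.lin x d}
      zero_mem' := ⟨1, fun C x => by rw [q_realize_one, map_zero]⟩
      add_mem' := by
        rintro a b ⟨r, hr⟩ ⟨s, hs⟩
        exact ⟨r * s, fun C x => by rw [q_realize_mul, hr, hs, map_add]⟩
      neg_mem' := by
        rintro a ⟨r, hr⟩
        exact ⟨r⁻¹, fun C x => by rw [q_realize_inv, hr, map_neg]⟩ }
  have h1 : ∀ i, ((Pi.single i 1, 0) : (ι → ℤ) × ℤ) ∈ S := fun i =>
    ⟨Term.var i, fun C x => by
      rw [lin_apply, Finset.sum_eq_single i] <;> simp +contextual⟩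
  have h2 : ((0, 1) : (ι → ℤ) × ℤ) ∈ S :=
    ⟨tauT, fun C x => (C.q_tau _).trans (by simp [lin_apply])⟩
  have h3 : d = ∑ i, d.1 i • ((Pi.single i 1, 0) : (ι → ℤ) × ℤ) + d.2 • ((0, 1) : (ι → ℤ) × ℤ) := by
    ext j
    · simp [Prod.fst_sum, Finset.sum_apply, Pi.single_apply]
    · simp [Prod.snd_sum]
  change d ∈ S
  rw [h3]
  exact S.add_mem (S.sum_mem fun i _ => S.zsmul_mem (h1 i) _) (S.zsmul_mem h2 _)

theorem Sim.sumElim {α : Type*} [Fintype α] {C : Coordinates H M A} {C' : Coordinates H M' A'}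
    {K : ℕ} {N : ℤ} {x : α → M} {y : α → M'} (h : Sim C C' K N x y) (xs : Fin 0 → M)
    (ys : Fin 0 → M') : Sim C C' K N (Sum.elim x xs) (Sum.elim y ys) where
  h_eq := by
    rintro (i | i)
    · exact h.h_eq i
    · exact i.elim0
  res := by
    rintro (i | i)
    · exact h.res i
    · exact i.elim0
  sign d hd := by
    have h1 : ‖((d.1 ∘ Sum.inl, d.2) : (α → ℤ) × ℤ)‖ ≤ K :=
      max_le ((pi_norm_le_iff_of_nonneg K.cast_nonneg).2 fun i =>
        (norm_le_pi_norm d.1 _).trans ((norm_fst_le d).trans hd)) ((norm_snd_le d).trans hd)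
    simpa [lin_apply] using h.sign _ h1

/-- Finitely many quantifier-free formulas, in which the elements of the torsion subgroup may occur
as the parameters `c`, determine a tuple up to similarity. -/
theorem exists_isQF_sim (H : Type u) [CommGroup H] [Finite H] (α : Type) [Fintype α] (K N : ℕ)
    (hN : 2 ≤ N) (hHN : Monoid.exponent H ∣ N) :
    ∃ (I : Type u) (_ : Finite I) (F : I → lang.Formula (α ⊕ H)), (∀ i, (F i).IsQF) ∧
      ∀ {M M' : Type v} [lang.Structure M] [lang.Structure M'] {A A' : Type w}
        [AddCommGroup A] [LinearOrder A] [AddCommGroup A'] [LinearOrder A']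
        (C : Coordinates H M A) (C' : Coordinates H M' A') (c : H → M) (c' : H → M'),
        (∀ k, C.h (c k) = k ∧ C.q (c k) = 0) → (∀ k, C'.h (c' k) = k ∧ C'.q (c' k) = 0) →
        ∀ (x : α → M) (y : α → M'),
          (∀ i, (F i).Realize (Sum.elim x c) ↔ (F i).Realize (Sum.elim y c')) →
          Sim C C' K N x y := by
  choose s hs using fun d : (α → ℤ) × ℤ => exists_realize_eq_lin.{u, v, w} d
  let B : Type := Metric.closedBall (0 : (α → ℤ) × ℤ) K
  have hB : Finite B := (isCompact_closedBall _ _).finite_of_discrete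
  let r : α × H × Fin N → lang.Term ((α ⊕ H) ⊕ Fin 0) := fun p =>
    Term.var (Sum.inl (Sum.inl p.1)) * (Term.var (Sum.inl (Sum.inr p.2.1)))⁻¹ *
      (tauT ^ (p.2.2 : ℕ))⁻¹
  let F : (α × H × Fin N) ⊕ B → lang.Formula (α ⊕ H) := Sum.elim
    (fun p => powF N hN (r p)) (fun d => leF ((s d).relabel (Sum.inl ∘ Sum.inl)) 1)
  refine ⟨_, inferInstance, F, ?_, ?_⟩
  · rintro (p | d)
    · exact (BoundedFormula.IsAtomic.rel _ _).isQF
    · exact (BoundedFormula.IsAtomic.rel _ _).isQF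
  · intro M M' _ _ A A' _ _ _ _ C C' c c' hc hc' x y hF
    have hpow : ∀ {M : Type v} [lang.Structure M] {A : Type w} [AddCommGroup A] [LinearOrder A]
        (C : Coordinates H M A) (c : H → M) (_ : ∀ k, C.h (c k) = k ∧ C.q (c k) = 0) (x : α → M)
        (i : α) (η : H) (j : Fin N), (F (Sum.inl (i, η, j))).Realize (Sum.elim x c) ↔
          C.h (x i) = η ∧ ∃ b, C.q (x i) = ((j : ℕ) : ℤ) • C.t + (N : ℤ) • b := by
      intro M _ A _ _ C c hc x i η j
      -- `N`-th powers are trivial in `H`, so that `P_N` determines the `H`-coordinate.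
      have hroot : ∀ a : H, (∃ k, k ^ N = a) ↔ a = 1 := fun a => by
        have h1 : ∀ k : H, k ^ N = 1 := fun k => by
          obtain ⟨e, rfl⟩ := hHN
          rw [pow_mul, Monoid.pow_exponent_eq_one, one_pow]
        simp [h1, eq_comm]
      refine (C.pow_iff N hN _).trans (and_congr ?_ (exists_congr fun b => ?_))
      · refine (hroot _).trans ?_
        change C.h ((r (i, η, j)).realize _) = 1 ↔ _
        rw [h_realize_mul, h_realize_mul, h_realize_inv, h_realize_inv, h_realize_tau_pow, inv_one,
          mul_one, mul_inv_eq_one]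
        simp [hc]
      · change _ = C.q ((r (i, η, j)).realize _) ↔ _
        rw [q_realize_mul, q_realize_mul, q_realize_inv, q_realize_inv, q_realize_tau_pow]
        simp only [Term.realize_var, Sum.elim_inl, Sum.elim_inr, hc, neg_zero, add_zero]
        rw [← sub_eq_add_neg, eq_sub_iff_add_eq, eq_comm, add_comm]
    have hle : ∀ {M : Type v} [lang.Structure M] {A : Type w} [AddCommGroup A] [LinearOrder A]
        (C : Coordinates H M A) (c : H → M) (x : α → M) (d : B),
        (F (Sum.inr d)).Realize (Sum.elim x c) ↔ C.lin x d ≤ 0 := by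
      intro M _ A _ _ C c x d
      refine (C.le_iff _).trans ?_
      change C.q (((s d).relabel _).realize _) ≤ C.q ((1 : lang.Term _).realize _) ↔ _
      rw [q_realize_one, Term.realize_relabel, hs]
      rfl
    have hmain : ∀ i, ∃ j : ℕ, C.h (x i) = C'.h (y i) ∧
        (∃ b, C.q (x i) = (j : ℤ) • C.t + (N : ℤ) • b) ∧
        ∃ b, C'.q (y i) = (j : ℤ) • C'.t + (N : ℤ) • b := by
      intro i
      obtain ⟨b, j, hj0, hjN, hb⟩ := C.isZGroup.division N (by omega) (C.q (x i))
      lift j to ℕ using hj0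
      have h1 := (hpow C c hc x i (C.h (x i)) ⟨j, by omega⟩).2 ⟨rfl, b, by rw [hb, add_comm]⟩
      have h2 := (hpow C' c' hc' y i _ _).1 ((hF _).1 h1)
      exact ⟨j, h2.1.symm, ⟨b, by rw [hb, add_comm]⟩, h2.2⟩
    refine ⟨fun i => (hmain i).choose_spec.1, fun i => ?_, fun d hd => ?_⟩
    · obtain ⟨j, -, h⟩ := hmain i
      exact ⟨j, h⟩
    · have hd' : d ∈ Metric.closedBall (0 : (α → ℤ) × ℤ) K := by
        rwa [mem_closedBall_zero_iff]
      exact (hle C c x ⟨d, hd'⟩).symm.trans ((hF _).trans (hle C' c' y ⟨d, hd'⟩))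

end Coordinates

section Existential

universe u v

/-- `c` is an injective homomorphism from `H` to the structure `M`. In a model of the theory it
enumerates the torsion subgroup. -/
def IsEnumeration {H : Type*} [CommGroup H] {M : Type*} [lang.Structure M] (c : H → M) : Prop :=
  Function.Injective c ∧ ∀ a b, c (a * b) = Structure.funMap (L := lang) Func.mul ![c a, c b]

/-- `M` contains a copy of `H`, and for each copy `c` there are coordinates in which `c` is the
subgroup `H × 0`. -/
def HasCoordinates (H : Type u) [CommGroup H] (M : Type v) [lang.Structure M] : Prop :=
  (∃ c : H → M, IsEnumeration c) ∧ ∀ c : H → M, IsEnumeration c →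
    ∃ (A : Type v) (_ : AddCommGroup A) (_ : LinearOrder A) (_ : IsOrderedAddMonoid A)
      (C : Coordinates H M A), ∀ k, C.h (c k) = k ∧ C.q (c k) = 0

theorem exists_isQF_isEnumeration (H : Type u) [CommGroup H] [Finite H] (α : Type) :
    ∃ ε : lang.Formula (α ⊕ H), ε.IsQF ∧ ∀ {M : Type v} [lang.Structure M] (x : α → M) (c : H → M),
      ε.Realize (Sum.elim x c) ↔ IsEnumeration c := by
  let X (h : H) : lang.Term ((α ⊕ H) ⊕ Fin 0) := Term.var (Sum.inl (Sum.inr h))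
  refine ⟨BoundedFormula.iInf (fun p : {p : H × H // p.1 ≠ p.2} => ∼((X p.1.1) =' (X p.1.2))) ⊓
    BoundedFormula.iInf (fun p : H × H => (X (p.1 * p.2)) =' (X p.1 * X p.2)), ?_, ?_⟩
  · refine (isQF_iInf fun p => BoundedFormula.IsQF.not ?_).inf (isQF_iInf fun p => ?_)
    · exact (BoundedFormula.IsAtomic.equal _ _).isQF
    · exact (BoundedFormula.IsAtomic.equal _ _).isQF
  · intro M _ x c
    rw [Formula.Realize, BoundedFormula.realize_inf, BoundedFormula.realize_iInf,
      BoundedFormula.realize_iInf]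
    refine and_congr ⟨fun h a b hab => ?_, fun h p => ?_⟩ ⟨fun h a b => ?_, fun h p => ?_⟩
    · by_contra hne
      exact (BoundedFormula.realize_not.1 (h ⟨(a, b), hne⟩)) hab
    · exact BoundedFormula.realize_not.2 fun h' => p.2 (h h')
    · exact (h (a, b)).trans (Term.realize_functions_apply₂ (L := lang))
    · exact (h p.1 p.2).trans (Term.realize_functions_apply₂ (L := lang) (t₁ := X p.1) (t₂ := X p.2)
        (v := Sum.elim (Sum.elim x c) default) (f := Func.mul)).symm

/-- In the structures with coordinates, every formula is equivalent to an existential one, which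
guesses an enumeration of the torsion subgroup and is quantifier-free over it. -/
theorem exists_isExistential_iff (H : Type u) [CommGroup H] [Finite H] {n : ℕ}
    (φ : lang.Formula (Fin n)) : ∃ ψ : lang.Formula (Fin n), ψ.IsExistential ∧
      ∀ (M : Type v) [lang.Structure M], HasCoordinates H M → ∀ x : Fin n → M,
        (φ.Realize x ↔ ψ.Realize x) := by
  classical
  obtain ⟨K, N, hN, hφ⟩ := Coordinates.exists_realize_iff_of_sim.{v, v, u, 0} φ
  have he : 0 < Monoid.exponent H := Monoid.exponent_pos.2 Monoid.ExponentExists.of_finite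
  lift N to ℕ using hN.le
  -- The factors make the modulus a multiple of the exponent and at least `2`.
  obtain ⟨I, _, F, hF, hsim⟩ := Coordinates.exists_isQF_sim.{u, v, v} H (Fin n) K
    (2 * (Monoid.exponent H * N)) (by
      have := Nat.mul_pos he (Nat.cast_pos.1 hN)
      omega) (Dvd.intro_left _ (by ring : 2 * N * Monoid.exponent H = _))
  obtain ⟨ε, hε, hε'⟩ := exists_isQF_isEnumeration.{u, v} H (Fin n)
  -- The sets of formulas `F i` that hold at some tuple satisfying `φ`.
  let P : Set (Set I) := {θ | ∃ (M : Type v) (_ : lang.Structure M) (A : Type v)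
    (_ : AddCommGroup A) (_ : LinearOrder A) (_ : IsOrderedAddMonoid A) (C : Coordinates H M A)
    (c : H → M) (x : Fin n → M), (∀ k, C.h (c k) = k ∧ C.q (c k) = 0) ∧ φ.Realize x ∧
      θ = {i | (F i).Realize (Sum.elim x c)}}
  let χ : P → lang.Formula (Fin n ⊕ H) := fun θ =>
    BoundedFormula.iInf fun i => if i ∈ θ.1 then F i else ∼(F i)
  refine ⟨Formula.iExs H (ε ⊓ BoundedFormula.iSup χ), isExistential_iExs (hε.inf
    (isQF_iSup fun θ => isQF_iInf fun i => ?_)), fun M _ hM x => ?_⟩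
  · split_ifs
    · exact hF i
    · exact (hF i).not
  · have hχ : ∀ (c : H → M) (θ : P), (χ θ).Realize (Sum.elim x c) ↔
        ∀ i, (i ∈ θ.1 ↔ (F i).Realize (Sum.elim x c)) := by
      intro c θ
      rw [Formula.Realize, BoundedFormula.realize_iInf]
      refine forall_congr' fun i => ?_
      split_ifs with hi
      · simp [hi, Formula.Realize]
      · simp [hi, Formula.Realize]
    rw [Formula.realize_iExs]
    constructor
    · intro hx
      obtain ⟨c, hc⟩ := hM.1
      obtain ⟨A, _, _, hA, C, hC⟩ := hM.2 c hc
      refine ⟨c, Formula.realize_inf.2 ⟨(hε' x c).2 hc, ?_⟩⟩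
      rw [Formula.Realize, BoundedFormula.realize_iSup]
      exact ⟨⟨_, M, _, A, _, _, hA, C, c, x, hC, hx, rfl⟩, (hχ c _).2 fun i => Iff.rfl⟩
    · rintro ⟨c, hc⟩
      obtain ⟨hc1, hc2⟩ := Formula.realize_inf.1 hc
      obtain ⟨A, _, _, _, C, hC⟩ := hM.2 c ((hε' x c).1 hc1)
      rw [Formula.Realize, BoundedFormula.realize_iSup] at hc2
      obtain ⟨⟨θ, M', _, A', _, _, _, C', c', x', hC', hx', rfl⟩, hθ⟩ := hc2
      have h := hsim C' C c' c hC' hC x' x ((hχ c _).1 hθ)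
      refine (hφ C' C x' default x default ((h.mono le_rfl ?_).sumElim _ _)).1 hx'
      exact Int.natCast_dvd_natCast.2 ⟨2 * Monoid.exponent H, by ring⟩

end Existential

/-! ### Realizations of the axioms -/

section Realize

variable {G : Type*} [CommGroup G] (le : G → G → Prop) (τ : G) {ι : Type*} {n : ℕ}

theorem realize_mul (v : ι → G) (s t : lang.Term ι) :
    letI := enrich le τ
    (s * t).realize v = s.realize v * t.realize v := rfl

theorem realize_inv (v : ι → G) (s : lang.Term ι) :
    letI := enrich le τ
    s⁻¹.realize v = (s.realize v)⁻¹ := rfl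

theorem realize_one (v : ι → G) :
    letI := enrich le τ
    (1 : lang.Term ι).realize v = 1 := rfl

theorem realize_tauT (v : ι → G) :
    letI := enrich le τ
    (tauT : lang.Term ι).realize v = τ := rfl

theorem realize_pow (v : ι → G) (s : lang.Term ι) (k : ℕ) :
    letI := enrich le τ
    (s ^ k).realize v = s.realize v ^ k := by
  induction k with
  | zero => exact (pow_zero _).symm
  | succ k ih =>
    rw [pow_succ, ← ih]
    rfl

theorem realize_leF (v : ι → G) (xs : Fin n → G) (s t : lang.Term (ι ⊕ Fin n)) :
    letI := enrich le τ
    (leF s t).Realize v xs ↔ le (s.realize (Sum.elim v xs)) (t.realize (Sum.elim v xs)) := Iff.rfl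

theorem realize_powF (v : ι → G) (xs : Fin n → G) (k : ℕ) (hk : 2 ≤ k)
    (t : lang.Term (ι ⊕ Fin n)) :
    letI := enrich le τ
    (powF k hk t).Realize v xs ↔ ∃ h : G, h ^ k = t.realize (Sum.elim v xs) := Iff.rfl

theorem realize_posF (v : ι → G) (xs : Fin n → G) (t : lang.Term (ι ⊕ Fin n)) :
    letI := enrich le τ
    (posF t).Realize v xs ↔
      le 1 (t.realize (Sum.elim v xs)) ∧ ¬ le (t.realize (Sum.elim v xs)) 1 := by
  let := enrich le τ
  rw [posF, BoundedFormula.realize_inf, BoundedFormula.realize_not, realize_leF, realize_leF,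
    realize_one]

theorem realize_orderF (v : ι → G) (xs : Fin n → G) {k : ℕ} (hk : 0 < k)
    (t : lang.Term (ι ⊕ Fin n)) :
    letI := enrich le τ
    (orderF k t).Realize v xs ↔ orderOf (t.realize (Sum.elim v xs)) = k := by
  let := enrich le τ
  rw [orderF, BoundedFormula.realize_inf, BoundedFormula.realize_iInf, orderOf_eq_iff hk]
  simp only [BoundedFormula.realize_not, BoundedFormula.realize_bdEqual, realize_pow,
    realize_one]
  exact and_congr_right fun _ => ⟨fun h m hm hm0 => h ⟨m, hm0, hm⟩, fun h m => h m m.2.2 m.2.1⟩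

theorem realize_groupAxioms_iff :
    letI := enrich le τ
    G ⊨ groupAxioms ↔ IsPreorderedGroup le := by
  let := enrich le τ
  simp only [groupAxioms, Theory.model_insert_iff, Theory.model_singleton_iff, Sentence.Realize,
    Formula.Realize, BoundedFormula.realize_all, BoundedFormula.realize_imp,
    BoundedFormula.realize_inf, BoundedFormula.realize_sup, BoundedFormula.realize_bdEqual,
    realize_leF, realize_mul, realize_inv, realize_one, Term.realize_var, Sum.elim_inr,
    Function.comp_apply, Fin.snoc]
  simp [mul_comm]
  exact ⟨fun h => ⟨h.2.1, h.2.2.1, h.2.2.2.1, h.2.2.2.2⟩, fun h =>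
    ⟨fun a b c => by rw [mul_left_comm, mul_comm c], h.refl, h.trans, h.total, h.mul_right⟩⟩

theorem realize_powAxiom (k : ℕ) (hk : 2 ≤ k) :
    letI := enrich le τ
    G ⊨ powAxiom k hk := by
  let := enrich le τ
  simp only [powAxiom, Sentence.Realize, Formula.Realize, BoundedFormula.realize_all,
    BoundedFormula.realize_iff, realize_powF, BoundedFormula.realize_ex,
    BoundedFormula.realize_bdEqual, realize_pow, Term.realize_var, Sum.elim_inr,
    Function.comp_apply, Fin.snoc]
  simp

theorem realize_noOrderAxiom_iff {k : ℕ} (hk : 0 < k) :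
    letI := enrich le τ
    G ⊨ noOrderAxiom k ↔ ∀ g : G, orderOf g ≠ k := by
  let := enrich le τ
  simp only [noOrderAxiom, Sentence.Realize, Formula.Realize, BoundedFormula.realize_all,
    BoundedFormula.realize_not, realize_orderF le τ _ _ hk, Term.realize_var, Sum.elim_inr,
    Function.comp_apply, Fin.snoc]
  simp

theorem realize_simAxiom_iff (m : ℕ) :
    letI := enrich le τ
    G ⊨ simAxiom m ↔ ∀ g : G, le g 1 → le 1 g → g ^ m = 1 := by
  let := enrich le τ
  simp only [simAxiom, Sentence.Realize, Formula.Realize, BoundedFormula.realize_all,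
    BoundedFormula.realize_imp, BoundedFormula.realize_inf, BoundedFormula.realize_bdEqual,
    realize_pow, realize_leF, realize_one, Term.realize_var, Sum.elim_inr, Function.comp_apply,
    Fin.snoc]
  simp

theorem realize_trivialAxiom_iff (m : ℕ) :
    letI := enrich le τ
    G ⊨ trivialAxiom m ↔ ∀ g h : G, g ^ m = 1 → h ^ m = 1 → le g h := by
  let := enrich le τ
  simp only [trivialAxiom, Sentence.Realize, Formula.Realize, BoundedFormula.realize_all,
    BoundedFormula.realize_imp, BoundedFormula.realize_inf, BoundedFormula.realize_bdEqual,
    realize_pow, realize_leF, realize_one, Term.realize_var, Sum.elim_inr, Function.comp_apply,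
    Fin.snoc]
  simp

theorem realize_leastAxiom_iff :
    letI := enrich le τ
    G ⊨ leastAxiom ↔ IsLeastPositive le τ := by
  let := enrich le τ
  simp only [leastAxiom, Sentence.Realize, Formula.Realize, BoundedFormula.realize_all,
    BoundedFormula.realize_imp, BoundedFormula.realize_inf, realize_posF, realize_tauT,
    realize_leF, Term.realize_var, Sum.elim_inr, Function.comp_apply, Fin.snoc]
  simp [IsLeastPositive]

theorem realize_divisionAxiom_iff (m k : ℕ) :
    letI := enrich le τ
    G ⊨ divisionAxiom m k ↔
      ∀ a : G, ∃ b w : G, w ^ m = 1 ∧ ∃ i < k, a = w * (b ^ k * τ ^ i) := by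
  let := enrich le τ
  simp only [divisionAxiom, Sentence.Realize, Formula.Realize, BoundedFormula.realize_all,
    BoundedFormula.realize_ex, BoundedFormula.realize_iSup, BoundedFormula.realize_inf,
    BoundedFormula.realize_bdEqual, realize_mul, realize_pow, realize_tauT, realize_one,
    Term.realize_var, Sum.elim_inr, Function.comp_apply, Fin.snoc]
  simp [Fin.exists_iff]

theorem realize_torsionAxiom_iff (H : Type*) [CommGroup H] [Finite H] :
    letI := enrich le τ
    G ⊨ torsionAxiom H ↔ ∃ x : H → G, (∀ a b, x (a * b) = x a * x b) ∧ Function.Injective x ∧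
      ∀ g : G, g ^ Monoid.exponent H = 1 ↔ ∃ h, g = x h := by
  let := enrich le τ
  simp only [torsionAxiom, Sentence.Realize, Formula.realize_iExs]
  refine exists_congr fun x => ?_
  simp only [Formula.Realize, BoundedFormula.realize_all, BoundedFormula.realize_iff,
    BoundedFormula.realize_not, BoundedFormula.realize_iSup, BoundedFormula.realize_iInf,
    BoundedFormula.realize_inf, BoundedFormula.realize_bdEqual, realize_mul, realize_pow,
    realize_one, Term.realize_var, Sum.elim_inr, Sum.elim_inl, Function.comp_apply, Fin.snoc]
  simp [and_assoc, Function.Injective, not_imp_not]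

end Realize

/-! ### The models of the theory -/

section Quotient

variable {G : Type*} [CommGroup G] {le : G → G → Prop} {K : Subgroup G}

/-- If the order is trivial on `K`, the induced relation on `G ⧸ K` does not depend on the choice of
representatives. -/
theorem quotientLE_mk_iff (hG : IsPreorderedGroup le) (hK : K ≤ simSubgroup hG) {g h : G} :
    quotientLE le K (QuotientGroup.mk g) (QuotientGroup.mk h) ↔ le g h := by
  have key : ∀ a b : G, (QuotientGroup.mk a : G ⧸ K) = QuotientGroup.mk b → le a b := by
    intro a b hab
    have := hG.mul_right _ _ a (hK (QuotientGroup.eq.1 hab)).2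
    rwa [one_mul, mul_comm, mul_inv_cancel_left] at this
  constructor
  · rintro ⟨a, b, hab, ha, hb⟩
    exact hG.trans _ _ _ (key _ _ ha.symm) (hG.trans _ _ _ hab (key _ _ hb))
  · exact fun h => ⟨_, _, h, rfl, rfl⟩

/-- The quotient by a subgroup on which the order is trivial is a model of Presburger arithmetic
if and only if the corresponding conditions hold in `G` modulo the subgroup. -/
theorem isPresburger_quotient_iff (hG : IsPreorderedGroup le) (hK : K ≤ simSubgroup hG) (τ : G) :
    IsPresburger (quotientLE le K) (QuotientGroup.mk τ) ↔
      simSubgroup hG ≤ K ∧ IsLeastPositive le τ ∧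
        ∀ n : ℕ, 2 ≤ n → ∀ a, ∃ b, ∃ w ∈ K, ∃ i < n, a = w * (b ^ n * τ ^ i) := by
  have hle := @quotientLE_mk_iff G _ le K hG hK
  have hdiv : ∀ (n i : ℕ) (a b : G), (QuotientGroup.mk a : G ⧸ K) =
      QuotientGroup.mk b ^ n * QuotientGroup.mk τ ^ i ↔ ∃ w ∈ K, a = w * (b ^ n * τ ^ i) := by
    intro n i a b
    rw [← QuotientGroup.mk_pow, ← QuotientGroup.mk_pow, ← QuotientGroup.mk_mul, eq_comm,
      QuotientGroup.eq]
    constructor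
    · exact fun h => ⟨_, h, by rw [mul_comm, mul_inv_cancel_left]⟩
    · rintro ⟨w, hw, rfl⟩
      rwa [mul_comm w, inv_mul_cancel_left]
  constructor
  · intro h
    refine ⟨fun g hg => ?_, ⟨⟨?_, ?_⟩, fun g h1 h2 => ?_⟩, fun n hn a => ?_⟩
    · rw [← QuotientGroup.eq_one_iff]
      exact h.antisymm _ _ (hle.2 hg.1) (hle.2 hg.2)
    · exact hle.1 h.least.1.1
    · exact fun h' => h.least.1.2 (hle.2 h')
    · exact hle.1 (h.least.2 _ (hle.2 h1) fun h' => h2 (hle.1 h'))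
    · obtain ⟨b, i, hi, hab⟩ := h.division n hn (QuotientGroup.mk a)
      obtain ⟨b, rfl⟩ := QuotientGroup.mk_surjective b
      obtain ⟨w, hw, hw'⟩ := (hdiv n i a b).1 hab
      exact ⟨b, w, hw, i, hi, hw'⟩
  · rintro ⟨h1, h2, h3⟩
    refine ⟨⟨?_, ?_, ?_, ?_⟩, ?_, ⟨⟨?_, ?_⟩, ?_⟩, ?_⟩
    · exact QuotientGroup.mk_surjective.forall.2 fun a => hle.2 (hG.refl a)
    · refine QuotientGroup.mk_surjective.forall₃.2 fun a b c hab hbc => hle.2 ?_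
      exact hG.trans _ _ _ (hle.1 hab) (hle.1 hbc)
    · exact QuotientGroup.mk_surjective.forall₂.2 fun a b => (hG.total a b).imp hle.2 hle.2
    · exact QuotientGroup.mk_surjective.forall₃.2 fun a b c hab =>
        hle.2 (hG.mul_right _ _ c (hle.1 hab))
    · refine QuotientGroup.mk_surjective.forall₂.2 fun a b hab hba => ?_
      refine QuotientGroup.eq.2 (h1 ⟨?_, ?_⟩)
      · have := hG.mul_right _ _ a⁻¹ (hle.1 hba)
        rwa [mul_inv_cancel, mul_comm] at this
      · have := hG.mul_right _ _ a⁻¹ (hle.1 hab)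
        rwa [mul_inv_cancel, mul_comm b] at this
    · exact hle.2 h2.1.1
    · exact fun h => h2.1.2 (hle.1 h)
    · exact QuotientGroup.mk_surjective.forall.2 fun a ha ha' =>
        hle.2 (h2.2 a (hle.1 ha) fun h => ha' (hle.2 h))
    · refine fun n hn => QuotientGroup.mk_surjective.forall.2 fun a => ?_
      obtain ⟨b, w, hw, i, hi, hab⟩ := h3 n hn a
      exact ⟨QuotientGroup.mk b, i, hi, (hdiv n i a b).2 ⟨w, hw, hab⟩⟩

end Quotient

section Models

variable (H : Type*) [CommGroup H] [Finite H] {G : Type*} [CommGroup G] (le : G → G → Prop) (τ : G)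

theorem exponent_pos_of_finite : 0 < Monoid.exponent H :=
  Monoid.exponent_pos.2 Monoid.ExponentExists.of_finite

theorem model_theoryT_iff_forall :
    letI := enrich le τ
    G ⊨ theoryT H ↔ IsPreorderedGroup le ∧
      (∀ k, 1 ≤ k → ¬ k ∣ Monoid.exponent H → ∀ g : G, orderOf g ≠ k) ∧
      (∃ x : H → G, (∀ a b, x (a * b) = x a * x b) ∧ Function.Injective x ∧
        ∀ g : G, g ^ Monoid.exponent H = 1 ↔ ∃ h, g = x h) ∧
      (∀ g : G, le g 1 → le 1 g → g ^ Monoid.exponent H = 1) ∧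
      (∀ g h : G, g ^ Monoid.exponent H = 1 → h ^ Monoid.exponent H = 1 → le g h) ∧
      IsLeastPositive le τ ∧
      ∀ k, 2 ≤ k → ∀ a : G, ∃ b w : G, w ^ Monoid.exponent H = 1 ∧
        ∃ i < k, a = w * (b ^ k * τ ^ i) := by
  let := enrich le τ
  have hpow : G ⊨ {φ : lang.Sentence | ∃ k hk, φ = powAxiom k hk} := by
    refine Theory.model_iff _ |>.2 ?_
    rintro _ ⟨k, hk, rfl⟩
    exact realize_powAxiom le τ k hk
  have hord : G ⊨ {φ : lang.Sentence | ∃ k, 1 ≤ k ∧ ¬ k ∣ Monoid.exponent H ∧ φ = noOrderAxiom k} ↔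
      ∀ k, 1 ≤ k → ¬ k ∣ Monoid.exponent H → ∀ g : G, orderOf g ≠ k := by
    rw [Theory.model_iff]
    constructor
    · exact fun h k hk hk' => (realize_noOrderAxiom_iff le τ hk).1 (h _ ⟨k, hk, hk', rfl⟩)
    · rintro h _ ⟨k, hk, hk', rfl⟩
      exact (realize_noOrderAxiom_iff le τ hk).2 (h k hk hk')
  have hdiv : G ⊨ {φ : lang.Sentence | ∃ k, 2 ≤ k ∧ φ = divisionAxiom (Monoid.exponent H) k} ↔
      ∀ k, 2 ≤ k → ∀ a : G, ∃ b w : G, w ^ Monoid.exponent H = 1 ∧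
        ∃ i < k, a = w * (b ^ k * τ ^ i) := by
    rw [Theory.model_iff]
    constructor
    · exact fun h k hk => (realize_divisionAxiom_iff le τ _ k).1 (h _ ⟨k, hk, rfl⟩)
    · rintro h _ ⟨k, hk, rfl⟩
      exact (realize_divisionAxiom_iff le τ _ k).2 (h k hk)
  simp only [theoryT, Theory.model_union_iff, Theory.model_insert_iff, Theory.model_singleton_iff,
    realize_groupAxioms_iff, realize_torsionAxiom_iff, realize_simAxiom_iff,
    realize_trivialAxiom_iff, realize_leastAxiom_iff, hpow, hord, hdiv, and_true, and_assoc]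

/-- The models of the theory are the intended structures. -/
theorem model_theoryT_iff :
    letI := enrich le τ
    G ⊨ theoryT H ↔ IsPresburgerModulo H le τ := by
  have hm := exponent_pos_of_finite H
  rw [model_theoryT_iff_forall]
  constructor
  · rintro ⟨hG, hord, ⟨x, hxm, hxi, hx⟩, hsim, htriv, hleast, hdiv⟩
    have htor : ∀ g : G, g ∈ CommGroup.torsion G ↔ g ^ Monoid.exponent H = 1 := by
      intro g
      rw [CommGroup.mem_torsion]
      refine ⟨fun hg => ?_, fun hg => isOfFinOrder_iff_pow_eq_one.2 ⟨_, hm, hg⟩⟩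
      by_contra hne
      exact hord _ hg.orderOf_pos (fun h => hne (orderOf_dvd_iff_pow_eq_one.1 h)) g rfl
    have hK : CommGroup.torsion G ≤ simSubgroup hG := fun g hg =>
      ⟨htriv _ _ ((htor g).1 hg) (one_pow _), htriv _ _ (one_pow _) ((htor g).1 hg)⟩
    refine ⟨hG, ?_, ?_, (isPresburger_quotient_iff hG hK τ).2 ⟨?_, hleast, ?_⟩⟩
    · let f : H →* CommGroup.torsion G :=
        MonoidHom.mk' (fun a => ⟨x a, (htor _).2 ((hx _).2 ⟨a, rfl⟩)⟩)
          fun a b => Subtype.ext (hxm a b)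
      refine ⟨(MulEquiv.ofBijective f ⟨fun a b hab => hxi (congrArg Subtype.val hab), ?_⟩).symm⟩
      rintro ⟨g, hg⟩
      obtain ⟨a, rfl⟩ := (hx g).1 ((htor g).1 hg)
      exact ⟨a, rfl⟩
    · exact fun g hg h hh => htriv _ _ ((htor g).1 hg) ((htor h).1 hh)
    · exact fun g hg => (htor g).2 (hsim g hg.1 hg.2)
    · intro n hn a
      obtain ⟨b, w, hw, h⟩ := hdiv n hn a
      exact ⟨b, w, (htor w).2 hw, h⟩
  · rintro ⟨hG, ⟨e⟩, htriv, hquot⟩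
    have htor : ∀ g : G, g ∈ CommGroup.torsion G ↔ g ^ Monoid.exponent H = 1 := by
      intro g
      refine ⟨fun hg => ?_, fun hg => ?_⟩
      · have h1 : (⟨g, hg⟩ : CommGroup.torsion G) ^ Monoid.exponent H = 1 := by
          rw [← e.map_eq_one_iff, map_pow, Monoid.pow_exponent_eq_one]
        exact congrArg Subtype.val h1
      · exact (CommGroup.mem_torsion _).2 (isOfFinOrder_iff_pow_eq_one.2 ⟨_, hm, hg⟩)
    have hK : CommGroup.torsion G ≤ simSubgroup hG := fun g hg =>
      ⟨htriv _ hg _ (one_mem _), htriv _ (one_mem _) _ hg⟩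
    obtain ⟨h1, h2, h3⟩ := (isPresburger_quotient_iff hG hK τ).1 hquot
    refine ⟨hG, ?_, ⟨fun a => e.symm a, ?_, ?_, ?_⟩, ?_, ?_, h2, ?_⟩
    · rintro k hk hkm g rfl
      have hg : g ∈ CommGroup.torsion G :=
        (CommGroup.mem_torsion _).2 (orderOf_pos_iff.1 hk)
      exact hkm (orderOf_dvd_of_pow_eq_one ((htor g).1 hg))
    · exact fun a b => congrArg Subtype.val (map_mul e.symm a b)
    · exact Subtype.val_injective.comp e.symm.injective
    · intro g
      rw [← htor]
      constructor
      · exact fun hg => ⟨e ⟨g, hg⟩, by simp⟩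
      · rintro ⟨a, rfl⟩
        exact (e.symm a).2
    · exact fun g hg hg' => (htor g).1 (h1 ⟨hg, hg'⟩)
    · exact fun g h hg hh => htriv g ((htor g).2 hg) h ((htor h).2 hh)
    · intro k hk a
      obtain ⟨b, w, hw, h⟩ := h3 k hk a
      exact ⟨b, w, (htor w).1 hw, h⟩

/-- Every model of the theory is the expansion of a pre-ordered abelian group. -/
theorem exists_eq_enrich (M : Type*) [S : lang.Structure M] (hM : M ⊨ theoryT H) :
    ∃ (_ : CommGroup M) (le : M → M → Prop) (τ : M), S = enrich le τ := by
  have hgrp : M ⊨ groupAxioms :=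
    hM.mono fun φ h => by simp only [theoryT, Set.mem_union]; tauto
  have hpow : ∀ k hk, M ⊨ powAxiom k hk := fun k hk =>
    (Theory.model_iff _).1 hM _ (by
      simp only [theoryT, Set.mem_union]
      exact Or.inl (Or.inl (Or.inl (Or.inr ⟨k, hk, rfl⟩))))
  let mul (a b : M) : M := Structure.funMap (L := lang) Func.mul ![a, b]
  let inv (a : M) : M := Structure.funMap (L := lang) Func.inv ![a]
  let one : M := Structure.funMap (L := lang) Func.one ![]
  have rmul : ∀ {ι : Type} (v : ι → M) (s t : lang.Term ι),
      (s * t).realize v = mul (s.realize v) (t.realize v) := fun v s t =>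
    Term.realize_functions_apply₂ (L := lang)
  have rinv : ∀ {ι : Type} (v : ι → M) (s : lang.Term ι),
      (s⁻¹).realize v = inv (s.realize v) := fun v s => Term.realize_functions_apply₁ (L := lang)
  have rone : ∀ {ι : Type} (v : ι → M), (1 : lang.Term ι).realize v = one := fun v =>
    congrArg (Structure.funMap (L := lang) Func.one) (Subsingleton.elim _ _)
  simp only [groupAxioms, Theory.model_insert_iff, Sentence.Realize,
    Formula.Realize, BoundedFormula.realize_all, BoundedFormula.realize_bdEqual,
    rmul, rinv, rone, Term.realize_var, Sum.elim_inr, Function.comp_apply, Fin.snoc] at hgrp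
  simp at hgrp
  obtain ⟨hassoc, hcomm, hone, hinv, -⟩ := hgrp
  let inst : CommGroup M :=
    { mul := mul
      one := one
      inv := inv
      mul_assoc := hassoc
      one_mul := fun a => (hcomm _ _).trans (hone a)
      mul_one := hone
      inv_mul_cancel := fun a => (hcomm _ _).trans (hinv a)
      mul_comm := hcomm }
  refine ⟨inst, fun a b => Structure.RelMap (L := lang) Rel.le ![a, b],
    Structure.funMap (L := lang) Func.tau ![], ?_⟩
  have rpow : ∀ {ι : Type} (v : ι → M) (s : lang.Term ι) (k : ℕ),
      (s ^ k).realize v = s.realize v ^ k := by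
    intro ι v s k
    induction k with
    | zero => exact (rone v).trans (pow_zero _).symm
    | succ k ih =>
      rw [pow_succ, ← ih]
      exact rmul v (s ^ k) s
  refine Structure.ext ?_ ?_
  · funext n f x
    cases f with
    | one => exact congrArg _ (Subsingleton.elim _ _)
    | tau => exact congrArg _ (Subsingleton.elim _ _)
    | inv => exact congrArg _ (by ext i; fin_cases i; rfl)
    | mul => exact congrArg _ (by ext i; fin_cases i <;> rfl)
  · funext n r x
    cases r with
    | le => exact congrArg _ (by ext i; fin_cases i <;> rfl)
    | pow k hk =>
      have h := hpow k hk
      simp only [powAxiom, powF, Sentence.Realize, Formula.Realize, BoundedFormula.realize_all,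
        BoundedFormula.realize_iff, BoundedFormula.realize_rel₁,
        BoundedFormula.realize_ex, BoundedFormula.realize_bdEqual, rpow, Term.realize_var,
        Sum.elim_inr, Function.comp_apply, Fin.snoc] at h
      have h' := h (x 0)
      have hx : x = ![x 0] := by ext i; fin_cases i; rfl
      rw [hx]
      refine propext (Iff.trans ?_ (Iff.rfl : (∃ a : M, a ^ k = x 0) ↔ _))
      simpa using h'

end Models

/-! ### Coordinates of the models, and model-completeness -/

section LinearOrder

variable {A : Type*} [CommGroup A] {le : A → A → Prop} {t : A}

/-- The linear order of a model of Presburger arithmetic, in additive notation. -/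
@[reducible]
noncomputable def IsPresburger.linearOrder (h : IsPresburger le t) : LinearOrder (Additive A) where
  le a b := le a.toMul b.toMul
  le_refl a := h.refl a.toMul
  le_trans a b c := h.trans a.toMul b.toMul c.toMul
  le_antisymm a b hab hba := h.antisymm a.toMul b.toMul hab hba
  le_total a b := h.total a.toMul b.toMul
  toDecidableLE := Classical.decRel _

theorem IsPresburger.isOrderedAddMonoid (h : IsPresburger le t) :
    letI := h.linearOrder
    IsOrderedAddMonoid (Additive A) :=
  let := h.linearOrder
  { add_le_add_left := fun a b hab c => h.mul_right a.toMul b.toMul c.toMul hab }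

theorem IsPresburger.isZGroup (h : IsPresburger le t) :
    letI := h.linearOrder
    IsZGroup (Additive.ofMul t) := by
  let := h.linearOrder
  refine ⟨?_, fun a ha => ?_, fun n hn a => ?_⟩
  · exact lt_iff_le_not_ge.2 h.least.1
  · have := lt_iff_le_not_ge.1 ha
    exact h.least.2 a.toMul this.1 this.2
  · rcases (by omega : n = 1 ∨ 2 ≤ n) with rfl | hn2
    · exact ⟨a, 0, le_rfl, one_pos, by simp⟩
    · lift n to ℕ using hn.le
      obtain ⟨b, i, hi, hab⟩ := h.division n (by omega) a.toMul
      refine ⟨Additive.ofMul b, i, by omega, by omega, ?_⟩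
      rw [natCast_zsmul, natCast_zsmul]
      exact hab

end LinearOrder

universe u v

/-- The intended structures are products of `H` and a `ℤ`-group: for an enumeration `c` of the
torsion subgroup, the coordinate in `H` of `g` is the unique `k` such that `g` is `c k * τ ^ j`
times an `m`-th power for some `j`, where `m` is the exponent of `H`. -/
theorem IsPresburgerModulo.hasCoordinates {H : Type u} [CommGroup H] [Finite H] {G : Type v}
    [CommGroup G] {le : G → G → Prop} {τ : G} (hG : IsPresburgerModulo H le τ) :
    letI := enrich le τ
    HasCoordinates H G := by
  let := enrich le τ
  obtain ⟨e⟩ := hG.torsion_equiv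
  refine ⟨⟨fun k => e.symm k, Subtype.val_injective.comp e.symm.injective,
    fun a b => congrArg Subtype.val (map_mul e.symm a b)⟩, fun c₀ hc₀ => ?_⟩
  let c : H →* G := MonoidHom.mk' c₀ hc₀.2
  have hc : Function.Injective c := hc₀.1
  set m := Monoid.exponent H with hm
  have hm0 : 0 < m := exponent_pos_of_finite H
  have hcm : ∀ k, c k ^ m = 1 := fun k => by
    rw [← map_pow, hm, Monoid.pow_exponent_eq_one, map_one]
  have hcT : ∀ k, c k ∈ CommGroup.torsion G := fun k =>
    (CommGroup.mem_torsion _).2 (isOfFinOrder_iff_pow_eq_one.2 ⟨m, hm0, hcm k⟩)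
  -- By counting, `c` enumerates the whole torsion subgroup.
  have hTc : ∀ w ∈ CommGroup.torsion G, ∃ k, c k = w := by
    intro w hw
    have hinj : Function.Injective fun k => e ⟨c k, hcT k⟩ := fun a b hab =>
      hc (congrArg Subtype.val (e.injective hab))
    obtain ⟨k, hk⟩ := Finite.injective_iff_surjective.1 hinj (e ⟨w, hw⟩)
    exact ⟨k, congrArg Subtype.val (e.injective hk)⟩
  have hK : CommGroup.torsion G ≤ simSubgroup hG.toIsPreorderedGroup := fun g hg =>
    ⟨hG.trivial_on_torsion _ hg _ (one_mem _), hG.trivial_on_torsion _ (one_mem _) _ hg⟩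
  let := hG.quotient.linearOrder
  have := hG.quotient.isOrderedAddMonoid
  have hZ := hG.quotient.isZGroup
  let q : G → Additive (G ⧸ CommGroup.torsion G) := fun g => Additive.ofMul (QuotientGroup.mk g)
  have hqmul : ∀ a b, q (a * b) = q a + q b := fun _ _ => rfl
  have hqdiv : ∀ a b, q (a * b⁻¹) = q a - q b := fun a b => by
    rw [hqmul, sub_eq_add_neg]
    rfl
  have hqpow : ∀ a (n : ℕ), q (a ^ n) = (n : ℤ) • q a := fun a n => by
    rw [natCast_zsmul]
    rfl
  have hqzpow : ∀ a (n : ℤ), q (a ^ n) = n • q a := fun _ _ => rfl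
  have hq0 : ∀ a, q a = 0 ↔ a ∈ CommGroup.torsion G := fun a => QuotientGroup.eq_one_iff a
  let P (k : H) (g : G) : Prop := ∃ z, ∃ j : ℤ, g = c k * (τ ^ j * z ^ m)
  have hPmul : ∀ {k k' g g'}, P k g → P k' g' → P (k * k') (g * g') := by
    rintro k k' _ _ ⟨z, j, rfl⟩ ⟨z', j', rfl⟩
    refine ⟨z * z', j + j', ?_⟩
    rw [map_mul, zpow_add, mul_pow, mul_mul_mul_comm, mul_mul_mul_comm (τ ^ j)]
  have hPinv : ∀ {k g}, P k g → P k⁻¹ g⁻¹ := by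
    rintro k _ ⟨z, j, rfl⟩
    exact ⟨z⁻¹, -j, by rw [map_inv, zpow_neg, inv_pow, mul_inv, mul_inv]⟩
  have hPc : ∀ k, P k (c k) := fun k => ⟨1, 0, by simp⟩
  have hPone : ∀ {k}, P k 1 → k = 1 := by
    rintro k ⟨z, j, h⟩
    have h1 : (m : ℤ) • (-q z) = j • q τ := by
      have h2 := congrArg q h
      rw [hqmul, hqmul, hqpow, hqzpow, (hq0 _).2 (hcT k), (hq0 _).2 (one_mem _), zero_add] at h2
      rw [smul_neg, neg_eq_iff_add_eq_zero, add_comm, ← h2]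
    obtain ⟨i, rfl⟩ := hZ.dvd_of_zsmul_eq (by omega) h1
    rw [mul_comm (m : ℤ), zpow_mul, zpow_natCast, ← mul_pow] at h
    have h3 : (τ ^ i * z) ^ m ∈ CommGroup.torsion G := by
      rw [← inv_eq_of_mul_eq_one_right h.symm]
      exact inv_mem (hcT k)
    have h4 : τ ^ i * z ∈ CommGroup.torsion G := by
      rw [CommGroup.mem_torsion] at h3 ⊢
      exact h3.of_pow hm0.ne'
    obtain ⟨w, hw⟩ := hTc _ h4
    rw [← hw, hcm, mul_one] at h
    exact hc (h.symm.trans (map_one c).symm)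
  have hPuniq : ∀ {k k' g}, P k g → P k' g → k = k' := by
    intro k k' g hk hk'
    have h := hPmul hk (hPinv hk')
    rw [mul_inv_cancel] at h
    exact mul_inv_eq_one.1 (hPone h)
  have hPex : ∀ g, ∃ k, P k g := by
    intro g
    obtain ⟨b, i, -, -, hb⟩ := hZ.division m (by omega) (q g)
    obtain ⟨z, rfl⟩ : ∃ z, q z = b := QuotientGroup.mk_surjective b
    have h1 : q (g * (τ ^ i * z ^ m)⁻¹) = 0 := by
      rw [hqdiv, hqmul, hqpow, hqzpow, sub_eq_zero, hb, add_comm]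
    obtain ⟨k, hk⟩ := hTc _ ((hq0 _).1 h1)
    exact ⟨k, z, i, by rw [hk, inv_mul_cancel_right]⟩
  choose h₀ hP using hPex
  let h : G →* H := MonoidHom.mk' h₀ fun a b => hPuniq (hP _) (hPmul (hP a) (hP b))
  have hhc : ∀ k, h (c k) = k := fun k => hPuniq (hP _) (hPc k)
  have hext : ∀ x y, h x = h y → q x = q y → x = y := by
    intro x y h1 h2
    obtain ⟨k, hk⟩ := hTc (x * y⁻¹) ((hq0 _).1 (by
      rw [hqdiv, h2, sub_self]))
    have h3 : k = 1 := by
      rw [← hhc k, hk, map_mul, map_inv, h1, mul_inv_cancel]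
    rw [h3, map_one] at hk
    exact (mul_inv_eq_one.1 hk.symm)
  have hsurj : ∀ k a, ∃ x, h x = k ∧ q x = a := by
    intro k a
    obtain ⟨g, rfl⟩ : ∃ g, q g = a := QuotientGroup.mk_surjective a
    refine ⟨g * c (k * (h g)⁻¹), ?_, ?_⟩
    · rw [map_mul, hhc, mul_comm, inv_mul_cancel_right]
    · rw [hqmul, (hq0 _).2 (hcT _), add_zero]
  refine ⟨_, inferInstance, inferInstance, this,
    { t := q τ
      isZGroup := hZ
      h := h
      q := q
      ext := hext
      surj := hsurj
      h_one := fun _ => map_one h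
      q_one := fun _ => rfl
      h_tau := fun _ => hPuniq (hP τ) ⟨1, 1, by simp⟩
      q_tau := fun _ => rfl
      h_inv := fun v => map_inv h (v 0)
      q_inv := fun _ => rfl
      h_mul := fun v => map_mul h (v 0) (v 1)
      q_mul := fun _ => rfl
      le_iff := fun v => (quotientLE_mk_iff hG.toIsPreorderedGroup hK).symm
      pow_iff := ?_ }, fun k => ⟨hhc k, (hq0 _).2 (hcT k)⟩⟩
  intro n hn v
  change (∃ g : G, g ^ n = v 0) ↔ _
  constructor
  · rintro ⟨g, hg⟩
    rw [← hg]
    exact ⟨⟨h g, (map_pow h g n).symm⟩, q g, (hqpow g n).symm⟩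
  · rintro ⟨⟨k, hk⟩, b, hb⟩
    obtain ⟨g, rfl, rfl⟩ := hsurj k b
    exact ⟨g, hext _ _ ((map_pow h g n).trans hk) ((hqpow g n).trans hb)⟩

theorem isModelComplete_theoryT (H : Type*) [CommGroup H] [Finite H] :
    IsModelComplete (theoryT H) := by
  intro n φ
  obtain ⟨ψ, hψ, h⟩ := exists_isExistential_iff H φ
  refine ⟨ψ, hψ, fun M v xs => ?_⟩
  rw [BoundedFormula.realize_iff]
  have hM : HasCoordinates H M := by
    obtain ⟨inst, le, τ, hS⟩ := exists_eq_enrich H M M.is_model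
    have hmod := M.is_model
    rw [hS] at hmod ⊢
    exact ((model_theoryT_iff H le τ).1 hmod).hasCoordinates
  have := h M hM v
  rwa [Formula.Realize, Formula.Realize, ← Subsingleton.elim xs default] at this

theorem IsModelComplete.mono {L : Language} {T T' : L.Theory} (h : IsModelComplete T)
    (hT : T ⊆ T') : IsModelComplete T' := fun n φ => by
  obtain ⟨ψ, hψ, hφ⟩ := h n φ
  exact ⟨ψ, hψ, fun M v xs => hφ (M.subtheoryModel hT) v xs⟩

section FiniteByPresburger

variable {G : Type*} [CommGroup G] {le : G → G → Prop}

theorem IsPreorderedGroup.le_one_of_pow_eq_one (hG : IsPreorderedGroup le) {g : G} (hg : le 1 g)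
    {n : ℕ} (hn : 0 < n) (h : g ^ n = 1) : le g 1 := by
  have key : ∀ k : ℕ, le g (g ^ (k + 1)) := by
    intro k
    induction k with
    | zero => simpa using hG.refl g
    | succ k ih =>
      have := hG.mul_right _ _ g (hG.trans _ _ _ hg ih)
      rw [one_mul, ← pow_succ] at this
      exact this
  have := key (n - 1)
  rwa [Nat.sub_add_cancel hn, h] at this

theorem torsion_le_simSubgroup (hG : IsPreorderedGroup le) :
    CommGroup.torsion G ≤ simSubgroup hG := by
  intro g hg
  obtain ⟨n, hn, hgn⟩ := isOfFinOrder_iff_pow_eq_one.1 ((CommGroup.mem_torsion _).1 hg)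
  rcases hG.total 1 g with h | h
  · exact ⟨hG.le_one_of_pow_eq_one h hn hgn, h⟩
  · have h1 : le 1 g⁻¹ := by
      have := hG.mul_right _ _ g⁻¹ h
      rwa [mul_inv_cancel, one_mul] at this
    have h2 := hG.mul_right _ _ g
      (hG.le_one_of_pow_eq_one h1 hn (by rw [inv_pow, hgn, inv_one]))
    rw [inv_mul_cancel, one_mul] at h2
    exact ⟨h, h2⟩

theorem torsion_eq_simSubgroup (hG : IsPreorderedGroup le) [Finite (simSubgroup hG)] :
    CommGroup.torsion G = simSubgroup hG := by
  refine le_antisymm (torsion_le_simSubgroup hG) fun g hg => ?_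
  exact (CommGroup.mem_torsion _).2 ((simSubgroup hG).subtype.isOfFinOrder
    (isOfFinOrder_of_finite (⟨g, hg⟩ : simSubgroup hG)))

theorem IsFiniteByPresburger.exists_isLeastPositive {hG : IsPreorderedGroup le}
    (h : IsFiniteByPresburger hG) : ∃ τ : G, IsLeastPositive le τ := by
  obtain ⟨-, t, ht⟩ := h
  obtain ⟨τ, rfl⟩ := QuotientGroup.mk_surjective t
  exact ⟨τ, ((isPresburger_quotient_iff hG le_rfl τ).1 ht).2.1⟩

theorem IsFiniteByPresburger.isPresburgerModulo {H : Type*} [CommGroup H]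
    {hG : IsPreorderedGroup le} (h : IsFiniteByPresburger hG) (e : simSubgroup hG ≃* H) {τ : G}
    (hτ : IsLeastPositive le τ) : IsPresburgerModulo H le τ := by
  obtain ⟨hfin, t, ht⟩ := h
  have htor := torsion_eq_simSubgroup hG
  obtain ⟨τ', rfl⟩ := QuotientGroup.mk_surjective t
  have h' := (isPresburger_quotient_iff hG le_rfl τ').1 ht
  have heq : (QuotientGroup.mk τ : G ⧸ simSubgroup hG) = QuotientGroup.mk τ' := by
    refine ht.antisymm _ _ ?_ ?_
    · exact (quotientLE_mk_iff hG le_rfl).2 (hτ.2 _ h'.2.1.1.1 h'.2.1.1.2)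
    · exact (quotientLE_mk_iff hG le_rfl).2 (h'.2.1.2 _ hτ.1.1 hτ.1.2)
  rw [← heq] at ht
  refine ⟨hG, ?_, fun g hg k hk => ?_, ?_⟩
  · rw [htor]
    exact ⟨e⟩
  · rw [htor] at hg hk
    exact hG.trans _ _ _ hg.1 hk.2
  · rw [htor]
    exact ht

end FiniteByPresburger

end FinByPres

theorem mainTheorem2 (H : Type*) [CommGroup H] [Finite H] :
    -- the theory is model-complete
    FinByPres.IsModelComplete (FinByPres.theoryT H) ∧
    -- it is the theory of pre-ordered abelian groups with torsion `H` and Presburger quotient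
    (∀ (G : Type*) [CommGroup G] (le : G → G → Prop) (τ : G),
      letI := FinByPres.enrich le τ
      G ⊨ FinByPres.theoryT H ↔ FinByPres.IsPresburgerModulo H le τ) ∧
    -- every finite-by-Presburger group with `{g | g ∼ 1} ≅ H` is model-complete
    (∀ (G : Type*) [CommGroup G] (le : G → G → Prop) (hG : FinByPres.IsPreorderedGroup le),
      FinByPres.IsFiniteByPresburger hG → Nonempty (FinByPres.simSubgroup hG ≃* H) →
      (∃ τ : G, FinByPres.IsLeastPositive le τ) ∧
      ∀ τ : G, FinByPres.IsLeastPositive le τ →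
        letI := FinByPres.enrich le τ
        G ⊨ FinByPres.theoryT H ∧
          FinByPres.IsModelComplete (FinByPres.lang.completeTheory G)) := by
  refine ⟨FinByPres.isModelComplete_theoryT H, fun G _ le τ => FinByPres.model_theoryT_iff H le τ,
    fun G _ le hG hfin ⟨e⟩ => ⟨hfin.exists_isLeastPositive, fun τ hτ => ?_⟩⟩
  let := FinByPres.enrich le τ
  have hmod : G ⊨ FinByPres.theoryT H :=
    (FinByPres.model_theoryT_iff H le τ).2 (hfin.isPresburgerModulo e hτ)
  exact ⟨hmod, (FinByPres.isModelComplete_theoryT H).mono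
    (Theory.model_iff_subset_completeTheory.1 hmod)⟩
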